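/- Let $A$ and $B$ be (not necessarily unital) $C^*$-algebras and let $\varphi\colon A\to B$ be a bounded linear map. Regard the biduals $A^{**}$ and $B^{**}$ as $*$-algebras with the Arens product and the canonical involution (so that they are the enveloping von Neumann algebras of $A$ and $B$, with $A\subseteq A^{**}$ and $B\subseteq B^{**}$ via the canonical embeddings), let $1$ be the unit of $A^{**}$, and let $\varphi^{**}\colon A^{**}\to B^{**}$ be the bitranspose of $\varphi$. The following are equivalent. 1. $\varphi$ is a weighted $*$-homomorphism: there are a $C^*$-algebra $D$ containing $B$ as a $C^*$-subalgebra, a $*$-homomorphism $\pi\colon A\to D$ and an element $h\in D$ such that $\varphi(a)=h\pi(a)=\pi(a)h$ for all $a\in A$. 2. There is a $*$-homomorphism $\pi_\varphi\colon A\to B^{**}$ such that $\varphi(a)=\varphi^{**}(1)\pi_\varphi(a)=\pi_\varphi(a)\varphi^{**}(1)$ for all $a\in A$. 3. $\varphi$ preserves range-orthogonality ($a^*b=0$ implies $\varphi(a)^*\varphi(b)=0$), domain-orthogonality ($ab^*=0$ implies $\varphi(a)\varphi(b)^*=0$) and zero-products ($ab=0$ implies $\varphi(a)\varphi(b)=0$).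 Moreover, if these conditions hold, then $\pi_\varphi$ in (2) can be chosen canonically: there is exactly one $*$-homomorphism $\pi_\varphi\colon A\to B^{**}$ such that, for all $a,b\in A$, $\pi_\varphi(a)\varphi(b)=\varphi(ab)$ and $\pi_\varphi(a)\varphi(b)^*=\varphi(ba^*)^*$, and such that $\pi_\varphi(a)x=0$ whenever $a\in A$ and $x\in B^{**}$ satisfies $\varphi(b)x=0=\varphi(b)^*x$ for all $b\in A$; and this $\pi_\varphi$ satisfies the identities in (2). -/

import Mathlib

universe u v w

noncomputable section

namespace CStarBidual

open ContinuousLinearMap NormedSpace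

/-- The bidual `A**` of a C⋆-algebra: the Banach space double dual. It is equipped below with the
Arens product and the canonical involution, which make it the usual enveloping algebra `A**`. -/
abbrev Bidual (A : Type u) [NonUnitalCStarAlgebra A] : Type u :=
  StrongDual ℂ (StrongDual ℂ A)

section Structure

variable {A : Type u} [NonUnitalCStarAlgebra A]

/-- The module action of `A` on its dual: `(f · x) y = f (x * y)`. -/
def dualAct : StrongDual ℂ A →L[ℂ] A →L[ℂ] StrongDual ℂ A :=
  ((compL ℂ A (A →L[ℂ] A) (StrongDual ℂ A)).flip (mul ℂ A)) ∘L (compL ℂ A A ℂ)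

theorem dualAct_apply (f : StrongDual ℂ A) (x y : A) : dualAct f x y = f (x * y) := rfl

/-- The action of the bidual on the dual: `(G · f) x = G (f · x)`. -/
def bidualAct (G : Bidual A) : StrongDual ℂ A →L[ℂ] StrongDual ℂ A :=
  (compL ℂ A (StrongDual ℂ A) ℂ G) ∘L dualAct

theorem bidualAct_apply (G : Bidual A) (f : StrongDual ℂ A) (x : A) :
    bidualAct G f x = G (dualAct f x) := rfl

/-- The (first) Arens product on the bidual: `(F * G) f = F (G · f)`. -/
instance instMulBidual : Mul (Bidual A) := ⟨fun F G => F ∘L bidualAct G⟩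

theorem bidual_mul_apply (F G : Bidual A) (f : StrongDual ℂ A) :
    (F * G) f = F (bidualAct G f) := rfl

/-- With the Arens product the bidual is a ring, on its usual additive group. -/
instance instRingBidual : NonUnitalRing (Bidual A) :=
  { (inferInstance : AddCommGroup (Bidual A)), instMulBidual with
    left_distrib := fun F G H => by
      ext f
      have h : bidualAct (G + H) f = bidualAct G f + bidualAct H f := by ext x; rfl
      change F (bidualAct (G + H) f) = F (bidualAct G f) + F (bidualAct H f)
      rw [h, map_add]
    right_distrib := fun F G H => rfl
    zero_mul := fun F => rfl
    mul_zero := fun F => by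
      ext f
      have h : bidualAct (0 : Bidual A) f = 0 := by ext x; rfl
      change F (bidualAct (0 : Bidual A) f) = 0
      rw [h, map_zero]
    mul_assoc := fun F G H => by
      ext f
      change F (bidualAct G (bidualAct H f)) = F (bidualAct (G * H) f)
      congr 1
      ext x
      change G (dualAct (bidualAct H f) x) = G (bidualAct H (dualAct f x))
      congr 1
      ext y
      change H (dualAct f (x * y)) = H (dualAct (dualAct f x) y)
      congr 1
      ext z
      change f (x * y * z) = f (x * (y * z))
      rw [mul_assoc] }

/-- The adjoint functional `x ↦ conj (f (x*))`. -/
def dualStar (f : StrongDual ℂ A) : StrongDual ℂ A :=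
  LinearMap.mkContinuous
    { toFun := fun x => star (f (star x))
      map_add' := fun x y => by simp
      map_smul' := fun c x => by simp } ‖f‖
    (fun x => by simpa using f.le_opNorm (star x))

theorem dualStar_apply (f : StrongDual ℂ A) (x : A) : dualStar f x = star (f (star x)) := rfl

theorem norm_dualStar_le (f : StrongDual ℂ A) : ‖dualStar f‖ ≤ ‖f‖ :=
  LinearMap.mkContinuous_norm_le _ (norm_nonneg f) _

/-- The involution on the bidual: `F* f = conj (F (f*))`. -/
instance instStarBidual : Star (Bidual A) :=
  ⟨fun F => LinearMap.mkContinuous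
    { toFun := fun f => star (F (dualStar f))
      map_add' := fun f g => by
        have h : dualStar (f + g) = dualStar f + dualStar g := by
          ext x; simp [dualStar_apply]
        simp [h]
      map_smul' := fun c f => by
        have h : dualStar (c • f) = star c • dualStar f := by
          ext x; simp [dualStar_apply]
        simp [h] } ‖F‖
    (fun f => by
      have h1 := F.le_opNorm (dualStar f)
      have h2 := mul_le_mul_of_nonneg_left (norm_dualStar_le f) (norm_nonneg F)
      simpa using h1.trans h2)⟩

theorem bidual_star_apply (F : Bidual A) (f : StrongDual ℂ A) :
    (star F) f = star (F (dualStar f)) := rfl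

/-- `e` is the unit of `A**` (there is at most one two-sided identity). -/
def IsUnitElement (e : Bidual A) : Prop := ∀ F : Bidual A, e * F = F ∧ F * e = F

theorem IsUnitElement.unique {e e' : Bidual A} (h : IsUnitElement e) (h' : IsUnitElement e') :
    e = e' := by
  rw [← (h' e).2, (h e').1]

end Structure

section Maps

variable {A : Type u} {B : Type v} [NonUnitalCStarAlgebra A] [NonUnitalCStarAlgebra B]

/-- The bitranspose `φ** : A** → B**`, `φ** F = F ∘ φ*` with `φ* f = f ∘ φ`. -/
def bitranspose (φ : A →L[ℂ] B) : Bidual A →L[ℂ] Bidual B :=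
  (compL ℂ (StrongDual ℂ B) (StrongDual ℂ A) ℂ).flip ((compL ℂ A B ℂ).flip φ)

theorem bitranspose_apply (φ : A →L[ℂ] B) (F : Bidual A) (f : StrongDual ℂ B) :
    bitranspose φ F f = F (f ∘L φ) := rfl

/-- `φ` preserves zero-products. -/
def PreservesZeroProducts (φ : A →L[ℂ] B) : Prop :=
  ∀ a b : A, a * b = 0 → φ a * φ b = 0

/-- `φ` preserves range-orthogonality. -/
def PreservesRangeOrthogonality (φ : A →L[ℂ] B) : Prop :=
  ∀ a b : A, star a * b = 0 → star (φ a) * φ b = 0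

/-- `φ` preserves domain-orthogonality. -/
def PreservesDomainOrthogonality (φ : A →L[ℂ] B) : Prop :=
  ∀ a b : A, a * star b = 0 → φ a * star (φ b) = 0

/-- `φ` is a weighted ⋆-homomorphism: for some C⋆-algebra `D` containing `B` (through an injective
⋆-homomorphism `i`), some ⋆-homomorphism `π : A → D` and some `h ∈ D`, one has
`φ a = h * π a = π a * h`. -/
def IsWeightedStarHom (φ : A →L[ℂ] B) : Prop :=
  ∃ (D : Type (max v w)) (_ : NonUnitalCStarAlgebra D) (i : B →⋆ₙₐ[ℂ] D) (π : A →⋆ₙₐ[ℂ] D) (h : D),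
    Function.Injective i ∧ ∀ a : A, i (φ a) = h * π a ∧ i (φ a) = π a * h

/-- `φ a = h * π a = π a * h` in `B**`, for all `a`. -/
def IsWeightedBy (φ : A →L[ℂ] B) (h : Bidual B) (π : A →⋆ₙₐ[ℂ] Bidual B) : Prop :=
  ∀ a : A, inclusionInDoubleDual ℂ B (φ a) = h * π a ∧
    inclusionInDoubleDual ℂ B (φ a) = π a * h

/-- The requirements that single out the canonical support ⋆-homomorphism of `φ`:
`π a * φ b = φ (a * b)`, `π a * (φ b)* = (φ (b * a*))*`, and `π a` vanishes off the ranges of the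
`φ b` and `(φ b)*`, i.e. on whatever is annihilated by all `φ b` and `(φ b)*`. -/
structure IsSupportHom (φ : A →L[ℂ] B) (π : A →⋆ₙₐ[ℂ] Bidual B) : Prop where
  mul_map : ∀ a b : A,
    π a * inclusionInDoubleDual ℂ B (φ b) = inclusionInDoubleDual ℂ B (φ (a * b))
  mul_star_map : ∀ a b : A,
    π a * inclusionInDoubleDual ℂ B (star (φ b)) =
      inclusionInDoubleDual ℂ B (star (φ (b * star a)))
  mul_eq_zero : ∀ (a : A) (x : Bidual B),
    (∀ b : A, inclusionInDoubleDual ℂ B (φ b) * x = 0 ∧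
      inclusionInDoubleDual ℂ B (star (φ b)) * x = 0) → π a * x = 0

end Maps

end CStarBidual

end

/-!
The universal representation identifies the biduals with unital C⋆-algebras. Cutting a function on
the spectrum of a selfadjoint element into slices shows that a bounded bilinear map `V` that
vanishes on zero-products satisfies `V (a * c) b = V a (c * b)`. Hence, if `φ` preserves the three
orthogonality relations, the product `X a * Y b` depends only on `a * b` for all `X` and `Y` among
`φ` and its adjoint map `a ↦ (φ a*)*`, and this passes to the bitransposes by weak⋆ continuity.

If `φ a = h * π a = π a * h`, then `T a = φ a * h* + (φ a*)* * h` equals `(h * h* + h* * h) * π a`.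
Conversely, with `h = φ** 1` and `k = h * h* + h* * h`, the map `π` is recovered as the weak⋆ limit
of `(k + ε)⁻¹ * T a` as `ε → 0`: these elements have norm at most `‖a‖`, since
`T a * (T a)* ≤ ‖a‖² k²`, and their products with `φ b` and `(φ b*)*` converge in norm to
`φ (a * b)` and `(φ (a * b)*)*`. An element of the form `π a * π b - π (a * b)`, or a difference of
two candidates for `π a`, annihilates the ranges of `φ` and of its adjoint map, hence vanishes.
-/

noncomputable section

namespace CStarBidual

open ContinuousLinearMap NormedSpace Filter Topology
open scoped ComplexOrder ComplexStarModule

section PositiveFunctionals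

variable {M : Type u} [NonUnitalCStarAlgebra M]

/-- The complex functional that agrees with the real functional `g` on selfadjoint elements. -/
def hermitianExtension (g : M →ₗ[ℝ] ℝ) : M →ₗ[ℂ] ℂ :=
  Module.Dual.extendRCLikeₗ (g ∘ₗ (selfAdjoint.submodule ℝ M).subtype ∘ₗ realPart)

theorem hermitianExtension_apply (g : M →ₗ[ℝ] ℝ) (x : M) :
    hermitianExtension g x = (g (ℜ x : M) : ℂ) + Complex.I * g (ℑ x : M) := by
  have h : (ℜ (Complex.I • x) : M) = -(ℑ x : M) := by
    rw [realPart_I_smul, NegMemClass.coe_neg]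
  change ((g (ℜ x : M) : ℝ) : ℂ) - Complex.I * ((g (ℜ (Complex.I • x) : M) : ℝ) : ℂ) = _
  rw [h, map_neg, Complex.ofReal_neg]
  ring

theorem hermitianExtension_sub (g u : M →ₗ[ℝ] ℝ) :
    hermitianExtension (g - u) = hermitianExtension g - hermitianExtension u := by
  simp only [hermitianExtension, LinearMap.sub_comp, map_sub]

theorem hermitianExtension_re_add_im (f : M →ₗ[ℂ] ℂ) :
    hermitianExtension (Complex.reLm ∘ₗ f.restrictScalars ℝ) +
      Complex.I • hermitianExtension (Complex.imLm ∘ₗ f.restrictScalars ℝ) = f := by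
  ext x
  conv_rhs => rw [← realPart_add_I_smul_imaginaryPart x, map_add, map_smul, smul_eq_mul,
    ← Complex.re_add_im (f (ℜ x : M)), ← Complex.re_add_im (f (ℑ x : M))]
  simp only [LinearMap.add_apply, LinearMap.smul_apply, hermitianExtension_apply,
    LinearMap.comp_apply, LinearMap.restrictScalars_apply, Complex.reLm_coe, Complex.imLm_coe,
    smul_eq_mul]
  ring

variable [PartialOrder M] [StarOrderedRing M]

theorem hermitianExtension_nonneg {g : M →ₗ[ℝ] ℝ} (hg : ∀ x, 0 ≤ x → 0 ≤ g x) {x : M}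
    (hx : 0 ≤ x) : 0 ≤ hermitianExtension g x := by
  have hs : IsSelfAdjoint x := .of_nonneg hx
  rw [hermitianExtension_apply, hs.coe_realPart, hs.imaginaryPart]
  simpa using hg x hx

/-- For a bounded real functional `u`, a cone in `M × ℝ` whose dual consists of the `(g, r)` with
`r ≥ 0`, `g ≥ 0`, `g ≥ r u` on `M₊` and `|g| ≤ r ‖u‖`; the parameters `b` and `z` of a member
are a positive element and a perturbation. -/
def dominationCone (u : StrongDual ℝ M) : PointedCone ℝ (M × ℝ) where
  carrier := {p | ∃ b z : M, 0 ≤ b ∧ b + z ≤ p.1 ∧ ‖u‖ * ‖z‖ ≤ p.2 + u b}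
  add_mem' := by
    rintro p q ⟨b, z, hb, hz, h⟩ ⟨b', z', hb', hz', h'⟩
    refine ⟨b + b', z + z', add_nonneg hb hb', ?_, ?_⟩
    · rw [add_add_add_comm]
      exact add_le_add hz hz'
    · have := mul_le_mul_of_nonneg_left (norm_add_le z z') (norm_nonneg u)
      rw [map_add, Prod.snd_add]
      linarith
  zero_mem' := ⟨0, 0, by simp⟩
  smul_mem' := by
    rintro ⟨c, hc⟩ p ⟨b, z, hb, hz, h⟩
    refine ⟨c • b, c • z, smul_nonneg hc hb, ?_, ?_⟩
    · rw [← smul_add]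
      exact smul_le_smul_of_nonneg_left hz hc
    · have := mul_le_mul_of_nonneg_left h hc
      rw [norm_smul, Real.norm_of_nonneg hc, map_smul]
      change _ ≤ c * p.2 + c * u b
      linarith

/-- The cone contains `(b + z, ‖u‖ ‖z‖ - u b)`, and `b ≤ -z` gives `u b ≤ ‖u‖ ‖z‖`, so it meets
`0 × ℝ` in the nonnegative half-line; the Riesz extension of the second coordinate is `g`. -/
theorem exists_nonneg_dominating (u : StrongDual ℝ M) :
    ∃ g : M →ₗ[ℝ] ℝ, ∀ x : M, 0 ≤ x → 0 ≤ g x ∧ u x ≤ g x := by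
  let f : M × ℝ →ₗ.[ℝ] ℝ :=
    ⟨LinearMap.ker (LinearMap.fst ℝ M ℝ), LinearMap.snd ℝ M ℝ ∘ₗ Submodule.subtype _⟩
  obtain ⟨G, hGf, hG⟩ := riesz_extension (dominationCone u) f
    (by
      rintro ⟨⟨x, s⟩, rfl : x = 0⟩ ⟨b, z, hb, hz, h⟩
      have hbz : ‖b‖ ≤ ‖z‖ := by
        rw [← norm_neg z]
        exact CStarAlgebra.norm_le_norm_of_nonneg_of_le hb (le_neg_iff_add_nonpos_right.mpr hz)
      have hub := (le_abs_self _).trans (u.le_opNorm b)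
      have := mul_le_mul_of_nonneg_left hbz (norm_nonneg u)
      change 0 ≤ s
      change _ ≤ s + u b at h
      linarith)
    (fun ⟨x, s⟩ => ⟨⟨(0, ‖u‖ * ‖x‖ - s), rfl⟩, 0, x, by simp⟩)
  have hG_snd (s : ℝ) : G (0, s) = s := hGf ⟨(0, s), rfl⟩
  refine ⟨G ∘ₗ LinearMap.inl ℝ M ℝ, fun x hx => ⟨hG _ ⟨0, 0, by simpa using hx⟩, ?_⟩⟩
  have h : 0 ≤ G (x, -u x) := hG _ ⟨x, 0, by simpa using hx⟩
  have hsum : G (x, -u x) = G (x, 0) + G (0, -u x) := by rw [← map_add]; simp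
  rw [hsum, hG_snd] at h
  exact sub_nonneg.mp h

theorem mem_span_positiveLinearMap (f : StrongDual ℂ M) :
    (f : M →ₗ[ℂ] ℂ) ∈
      Submodule.span ℂ (Set.range fun g : M →ₚ[ℂ] ℂ => (g : M →ₗ[ℂ] ℂ)) := by
  have mem_of_nonneg (g : M →ₗ[ℝ] ℝ) (hg : ∀ x, 0 ≤ x → 0 ≤ g x) :
      hermitianExtension g ∈
        Submodule.span ℂ (Set.range fun g : M →ₚ[ℂ] ℂ => (g : M →ₗ[ℂ] ℂ)) :=
    Submodule.subset_span
      ⟨.mk₀ (hermitianExtension g) fun _ => hermitianExtension_nonneg hg, rfl⟩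
  have mem_of_bounded (u : StrongDual ℝ M) :
      hermitianExtension (u : M →ₗ[ℝ] ℝ) ∈
        Submodule.span ℂ (Set.range fun g : M →ₚ[ℂ] ℂ => (g : M →ₗ[ℂ] ℂ)) := by
    obtain ⟨g, hg⟩ := exists_nonneg_dominating u
    rw [← sub_sub_cancel g (u : M →ₗ[ℝ] ℝ), hermitianExtension_sub]
    exact sub_mem (mem_of_nonneg g fun x hx => (hg x hx).1)
      (mem_of_nonneg _ fun x hx => sub_nonneg.mpr (hg x hx).2)
  rw [← hermitianExtension_re_add_im (f : M →ₗ[ℂ] ℂ)]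
  exact add_mem (mem_of_bounded (Complex.reCLM ∘L f.restrictScalars ℝ))
    (Submodule.smul_mem _ _ (mem_of_bounded (Complex.imCLM ∘L f.restrictScalars ℝ)))

end PositiveFunctionals

section Representations

open scoped CStarAlgebra

variable {B : Type v} [NonUnitalCStarAlgebra B] {H : Type*} [NormedAddCommGroup H]
  [InnerProductSpace ℂ H] [CompleteSpace H]

/-- The vector functionals `b ↦ ⟪ξ, ρ b η⟫` of a representation, as a sesquilinear map of
`(ξ, η)`. -/
def vectorFunctional (ρ : B →⋆ₙₐ[ℂ] (H →L[ℂ] H)) : H →L⋆[ℂ] H →L[ℂ] StrongDual ℂ B :=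
  (((compL ℂ H (B →L[ℂ] H) (StrongDual ℂ B)).flip (ContinuousLinearMap.mk ρ).flip) ∘L
    compL ℂ B H ℂ).comp (innerSL ℂ)

theorem vectorFunctional_apply (ρ : B →⋆ₙₐ[ℂ] (H →L[ℂ] H)) (ξ η : H) (b : B) :
    vectorFunctional ρ ξ η b = inner ℂ ξ (ρ b η) := rfl

theorem norm_vectorFunctional_apply_le (ρ : B →⋆ₙₐ[ℂ] (H →L[ℂ] H)) (ξ η : H) :
    ‖vectorFunctional ρ ξ η‖ ≤ ‖ξ‖ * ‖η‖ :=
  opNorm_le_bound _ (by positivity) fun b => calc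
    ‖inner ℂ ξ (ρ b η)‖ ≤ ‖ξ‖ * ‖ρ b η‖ := norm_inner_le_norm _ _
    _ ≤ ‖ξ‖ * (‖b‖ * ‖η‖) := by
      gcongr
      exact (ρ b).le_of_opNorm_le (NonUnitalStarAlgHom.norm_apply_le ρ b) η
    _ = ‖ξ‖ * ‖η‖ * ‖b‖ := by ring

/-- The operator whose matrix coefficients are `⟪ξ, T η⟫ = F ⟪ξ, ρ · η⟫`. -/
def bidualOperator (ρ : B →⋆ₙₐ[ℂ] (H →L[ℂ] H)) (F : Bidual B) : H →L[ℂ] H :=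
  adjoint (InnerProductSpace.continuousLinearMapOfBilin
    ((compL ℂ H (StrongDual ℂ B) ℂ F).comp (vectorFunctional ρ)))

theorem inner_bidualOperator (ρ : B →⋆ₙₐ[ℂ] (H →L[ℂ] H)) (F : Bidual B) (ξ η : H) :
    inner ℂ ξ (bidualOperator ρ F η) = F (vectorFunctional ρ ξ η) := by
  rw [bidualOperator, adjoint_inner_right, InnerProductSpace.continuousLinearMapOfBilin_apply]
  rfl

theorem norm_bidualOperator_le (ρ : B →⋆ₙₐ[ℂ] (H →L[ℂ] H)) (F : Bidual B) :
    ‖bidualOperator ρ F‖ ≤ ‖F‖ :=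
  opNorm_le_of_re_inner_le (norm_nonneg F) fun ξ η hξ hη => by
    rw [inner_re_symm, inner_bidualOperator]
    calc RCLike.re (F (vectorFunctional ρ η ξ))
        ≤ ‖F (vectorFunctional ρ η ξ)‖ := RCLike.re_le_norm _
      _ ≤ ‖F‖ * (‖η‖ * ‖ξ‖) := F.le_opNorm_of_le (norm_vectorFunctional_apply_le ρ η ξ)
      _ = ‖F‖ := by rw [hξ, hη, mul_one, mul_one]

theorem bidualAct_vectorFunctional (ρ : B →⋆ₙₐ[ℂ] (H →L[ℂ] H)) (G : Bidual B) (ξ η : H) :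
    bidualAct G (vectorFunctional ρ ξ η) = vectorFunctional ρ ξ (bidualOperator ρ G η) := by
  ext x
  rw [bidualAct_apply, vectorFunctional_apply, ← adjoint_inner_left, inner_bidualOperator]
  congr 1
  ext y
  rw [dualAct_apply, vectorFunctional_apply, vectorFunctional_apply, map_mul, mul_apply_eq_comp,
    adjoint_inner_left]

theorem dualStar_vectorFunctional (ρ : B →⋆ₙₐ[ℂ] (H →L[ℂ] H)) (ξ η : H) :
    dualStar (vectorFunctional ρ ξ η) = vectorFunctional ρ η ξ := by
  ext b
  rw [dualStar_apply, vectorFunctional_apply, vectorFunctional_apply, map_star, star_eq_adjoint,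
    adjoint_inner_right]
  exact inner_conj_symm _ _

/-- The extension of a representation of `B` to a representation of `B**`. -/
def bidualExtension (ρ : B →⋆ₙₐ[ℂ] (H →L[ℂ] H)) : Bidual B →⋆ₙₐ[ℂ] (H →L[ℂ] H) where
  toFun := bidualOperator ρ
  map_add' F G := by
    ext η
    refine ext_inner_left ℂ fun ξ => ?_
    simp only [inner_bidualOperator, add_apply, inner_add_right]
  map_zero' := by
    ext η
    refine ext_inner_left ℂ fun ξ => ?_
    simp only [inner_bidualOperator, zero_apply, inner_zero_right]
  map_smul' c F := by
    ext η
    refine ext_inner_left ℂ fun ξ => ?_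
    simp only [inner_bidualOperator, smul_apply, inner_smul_right, MonoidHom.id_apply,
      smul_eq_mul]
  map_mul' F G := by
    ext η
    refine ext_inner_left ℂ fun ξ => ?_
    rw [mul_apply_eq_comp, inner_bidualOperator, inner_bidualOperator, bidual_mul_apply,
      bidualAct_vectorFunctional]
  map_star' F := by
    ext η
    refine ext_inner_left ℂ fun ξ => ?_
    rw [star_eq_adjoint, adjoint_inner_right, inner_bidualOperator, bidual_star_apply,
      dualStar_vectorFunctional, ← inner_conj_symm, inner_bidualOperator]
    rfl

theorem norm_apply_vectorFunctional_le (ρ : B →⋆ₙₐ[ℂ] (H →L[ℂ] H)) (F : Bidual B) (ξ η : H) :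
    ‖F (vectorFunctional ρ ξ η)‖ ≤ ‖ξ‖ * ‖η‖ * ‖bidualExtension ρ F‖ := by
  rw [← inner_bidualOperator]
  calc ‖inner ℂ ξ (bidualOperator ρ F η)‖ ≤ ‖ξ‖ * ‖bidualOperator ρ F η‖ := norm_inner_le_norm _ _
    _ ≤ ‖ξ‖ * (‖bidualOperator ρ F‖ * ‖η‖) := by
      gcongr
      exact (bidualOperator ρ F).le_opNorm η
    _ = ‖ξ‖ * ‖η‖ * ‖bidualExtension ρ F‖ := by
      rw [mul_comm ‖bidualOperator ρ F‖, mul_assoc]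
      rfl

theorem exists_gns_vector {M : Type u} [CStarAlgebra M] [PartialOrder M] [StarOrderedRing M]
    (f : M →ₚ[ℂ] ℂ) : ∃ ξ : f.GNS, ∀ x, inner ℂ ξ (f.gnsNonUnitalStarAlgHom x ξ) = f x := by
  refine ⟨((f.toPreGNS 1 : f.PreGNS) : f.GNS), fun x => ?_⟩
  rw [f.gnsNonUnitalStarAlgHom_apply_coe, UniformSpace.Completion.inner_coe, f.preGNS_inner_def]
  simp

end Representations

section Embedding

open scoped ENNReal

variable {B : Type v} [NonUnitalCStarAlgebra B]

/-- The direct sum of the extensions to `B**` of a family of representations of `B`. -/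
def bidualSum {ι : Type w} {H : ι → Type u} [∀ i, NormedAddCommGroup (H i)]
    [∀ i, InnerProductSpace ℂ (H i)] [∀ i, CompleteSpace (H i)]
    (ρ : ∀ i, B →⋆ₙₐ[ℂ] (H i →L[ℂ] H i)) :
    Bidual B →⋆ₙₐ[ℂ] lp (fun i => H i →L[ℂ] H i) ∞ where
  toFun F := ⟨fun i => bidualExtension (ρ i) F,
    memℓp_infty ⟨‖F‖, by rintro _ ⟨i, rfl⟩; exact norm_bidualOperator_le _ F⟩⟩
  map_add' F G := Subtype.ext <| funext fun i => map_add (bidualExtension (ρ i)) F G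
  map_zero' := Subtype.ext <| funext fun i => map_zero (bidualExtension (ρ i))
  map_smul' c F := Subtype.ext <| funext fun i => map_smul (bidualExtension (ρ i)) c F
  map_mul' F G := Subtype.ext <| funext fun i => map_mul (bidualExtension (ρ i)) F G
  map_star' F := Subtype.ext <| funext fun i => map_star (bidualExtension (ρ i)) F

theorem norm_bidualSum_le {ι : Type w} {H : ι → Type u} [∀ i, NormedAddCommGroup (H i)]
    [∀ i, InnerProductSpace ℂ (H i)] [∀ i, CompleteSpace (H i)]
    (ρ : ∀ i, B →⋆ₙₐ[ℂ] (H i →L[ℂ] H i)) (F : Bidual B) : ‖bidualSum ρ F‖ ≤ ‖F‖ :=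
  lp.norm_le_of_forall_le (norm_nonneg F) fun i => norm_bidualOperator_le (ρ i) F

theorem exists_norm_apply_le_bidualSum {ι : Type w} {H : ι → Type u} [∀ i, NormedAddCommGroup (H i)]
    [∀ i, InnerProductSpace ℂ (H i)] [∀ i, CompleteSpace (H i)]
    (ρ : ∀ i, B →⋆ₙₐ[ℂ] (H i →L[ℂ] H i)) {f : StrongDual ℂ B}
    (hf : f ∈ Submodule.span ℂ {f | ∃ i ξ η, f = vectorFunctional (ρ i) ξ η}) :
    ∃ C : ℝ, ∀ F : Bidual B, ‖F f‖ ≤ C * ‖bidualSum ρ F‖ := by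
  induction hf using Submodule.span_induction with
  | mem f hf =>
    obtain ⟨i, ξ, η, rfl⟩ := hf
    refine ⟨‖ξ‖ * ‖η‖, fun F => (norm_apply_vectorFunctional_le (ρ i) F ξ η).trans ?_⟩
    gcongr
    exact lp.norm_apply_le_norm ENNReal.top_ne_zero (bidualSum ρ F) i
  | zero => exact ⟨0, fun F => by simp⟩
  | add f g _ _ hf hg =>
    obtain ⟨C, hC⟩ := hf
    obtain ⟨C', hC'⟩ := hg
    refine ⟨C + C', fun F => ?_⟩
    rw [map_add, add_mul]
    exact norm_add_le_of_le (hC F) (hC' F)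
  | smul c f _ hf =>
    obtain ⟨C, hC⟩ := hf
    refine ⟨‖c‖ * C, fun F => ?_⟩
    rw [map_smul, norm_smul, mul_assoc]
    exact mul_le_mul_of_nonneg_left (hC F) (norm_nonneg c)

theorem exists_bound_of_pointwise_bound {V W : Type*} [NormedAddCommGroup V] [NormedSpace ℂ V]
    [CompleteSpace V] [SeminormedAddCommGroup W] [NormedSpace ℂ W] {Φ : StrongDual ℂ V → W}
    (hsmul : ∀ (c : ℂ) F, Φ (c • F) = c • Φ F)
    (hΦ : ∀ v, ∃ C : ℝ, ∀ F, ‖F v‖ ≤ C * ‖Φ F‖) : ∃ C : ℝ, 0 ≤ C ∧ ∀ F, ‖F‖ ≤ C * ‖Φ F‖ := by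
  have h_zero : Φ 0 = 0 := by rw [← zero_smul ℂ (0 : StrongDual ℂ V), hsmul, zero_smul]
  choose c hc using hΦ
  obtain ⟨C, hC⟩ := banach_steinhaus (g := fun F : {F // ‖Φ F‖ ≤ 1} => F.1) fun v =>
    ⟨|c v|, fun F => (hc v F).trans <| (mul_le_mul_of_nonneg_right (le_abs_self _)
      (norm_nonneg _)).trans (mul_le_of_le_one_right (abs_nonneg _) F.2)⟩
  have hC0 : 0 ≤ C := (norm_nonneg _).trans (hC ⟨0, by simp [h_zero]⟩)
  refine ⟨C, hC0, fun F => ?_⟩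
  rcases (norm_nonneg (Φ F)).eq_or_lt with h0 | hpos
  · have hF : F = 0 := by
      ext v
      simpa [← h0] using hc v F
    rw [hF, norm_zero]
    positivity
  · have h := hC ⟨((‖Φ F‖⁻¹ : ℝ) : ℂ) • F, by
      rw [hsmul, norm_smul, Complex.norm_real, norm_inv, norm_norm, inv_mul_cancel₀ hpos.ne']⟩
    rwa [norm_smul, Complex.norm_real, norm_inv, norm_norm, inv_mul_le_iff₀' hpos] at h

theorem exists_bidual_embedding_of_span {ι : Type w} {H : ι → Type u}
    [∀ i, NormedAddCommGroup (H i)] [∀ i, InnerProductSpace ℂ (H i)] [∀ i, CompleteSpace (H i)]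
    (ρ : ∀ i, B →⋆ₙₐ[ℂ] (H i →L[ℂ] H i))
    (hρ : ∀ f, f ∈ Submodule.span ℂ {f | ∃ i ξ η, f = vectorFunctional (ρ i) ξ η}) :
    ∃ (D : Type (max u w)) (_ : NonUnitalCStarAlgebra D) (Φ : Bidual B →⋆ₙₐ[ℂ] D) (C : ℝ),
      0 ≤ C ∧ ∀ F, ‖Φ F‖ ≤ ‖F‖ ∧ ‖F‖ ≤ C * ‖Φ F‖ := by
  obtain ⟨C, hC0, hC⟩ : ∃ C : ℝ, 0 ≤ C ∧ ∀ F : Bidual B, ‖F‖ ≤ C * ‖bidualSum ρ F‖ :=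
    exists_bound_of_pointwise_bound (bidualSum ρ).map_smul' fun f =>
      exists_norm_apply_le_bidualSum ρ (hρ f)
  exact ⟨lp (fun i => H i →L[ℂ] H i) ∞, inferInstance, bidualSum ρ, C, hC0,
    fun F => ⟨norm_bidualSum_le ρ F, hC F⟩⟩

variable (B)

/-- The universal representation: a functional on `B` is, via the unitization, a combination of
positive ones, hence of vector functionals of the Gelfand-Naimark-Segal representations. -/
theorem exists_bidual_embedding :
    ∃ (D : Type (max v w)) (_ : NonUnitalCStarAlgebra D) (Φ : Bidual B →⋆ₙₐ[ℂ] D) (C : ℝ),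
      0 ≤ C ∧ ∀ F, ‖Φ F‖ ≤ ‖F‖ ∧ ‖F‖ ≤ C * ‖Φ F‖ := by
  let _ : PartialOrder (Unitization ℂ B) := CStarAlgebra.spectralOrder _
  have _ : StarOrderedRing (Unitization ℂ B) := CStarAlgebra.spectralOrderedRing _
  let ρ (g : ULift.{w} (Unitization ℂ B →ₚ[ℂ] ℂ)) : B →⋆ₙₐ[ℂ] (g.down.GNS →L[ℂ] g.down.GNS) :=
    g.down.gnsNonUnitalStarAlgHom.comp (Unitization.inrNonUnitalStarAlgHom ℂ B)
  let S : Submodule ℂ (StrongDual ℂ B) :=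
    Submodule.span ℂ {f | ∃ i ξ η, f = vectorFunctional (ρ i) ξ η}
  have restrict_mem : Submodule.span ℂ
      (Set.range fun g : Unitization ℂ B →ₚ[ℂ] ℂ => (g : Unitization ℂ B →ₗ[ℂ] ℂ)) ≤
        (S.map (coeLM ℂ)).comap (LinearMap.lcomp ℂ ℂ (Unitization.inrHom ℂ ℂ B)) := by
    rw [Submodule.span_le]
    rintro _ ⟨g, rfl⟩
    obtain ⟨ξ, hξ⟩ := exists_gns_vector g
    exact ⟨vectorFunctional (ρ ⟨g⟩) ξ ξ, Submodule.subset_span ⟨⟨g⟩, ξ, ξ, rfl⟩,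
      LinearMap.ext fun b => hξ b⟩
  have mem_S (f : StrongDual ℂ B) : f ∈ S := by
    obtain ⟨g, hg, hgf⟩ := restrict_mem (mem_span_positiveLinearMap
      (f ∘L ⟨Unitization.sndHom ℂ ℂ B, Unitization.continuous_snd⟩))
    rwa [show f = g from (coe_injective hgf).symm]
  exact exists_bidual_embedding_of_span.{v, v, max v w} ρ mem_S

end Embedding

local notation "κ" => inclusionInDoubleDual ℂ _

section BidualAlgebra

variable {B : Type v} [NonUnitalCStarAlgebra B]

instance isScalarTower_bidual : IsScalarTower ℂ (Bidual B) (Bidual B) := ⟨fun _ _ _ => rfl⟩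

instance smulCommClass_bidual : SMulCommClass ℂ (Bidual B) (Bidual B) where
  smul_comm c F G := by
    ext f
    change c * F (bidualAct G f) = F (bidualAct (c • G) f)
    rw [← smul_eq_mul, ← map_smul]
    rfl

theorem inclusion_mul (a b : B) : (κ (a * b) : Bidual B) = κ a * κ b := rfl

theorem inclusion_star (a : B) : (κ (star a) : Bidual B) = star (κ a) := by
  ext f
  rw [bidual_star_apply, dual_def, dual_def, dualStar_apply, star_star]

theorem inclusion_injective : Function.Injective (κ : B → Bidual B) :=
  (inclusionInDoubleDualLi ℂ (E := B)).injective

theorem exists_injective_bidual_hom (B : Type v) [NonUnitalCStarAlgebra B] :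
    ∃ (D : Type v) (_ : NonUnitalCStarAlgebra D) (Φ : Bidual B →⋆ₙₐ[ℂ] D),
      Function.Injective Φ := by
  obtain ⟨D, _, Φ, C, -, hΦ⟩ := exists_bidual_embedding.{v, v} B
  refine ⟨D, _, Φ, (injective_iff_map_eq_zero Φ).mpr fun F hF => ?_⟩
  have h := (hΦ F).2
  rw [hF, norm_zero, mul_zero] at h
  exact (norm_le_zero_iff (E := Bidual B)).mp h

theorem bidual_star_mul (F G : Bidual B) : star (F * G) = star G * star F := by
  obtain ⟨D, _, Φ, hΦ⟩ := exists_injective_bidual_hom B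
  exact hΦ (by simp only [map_star, map_mul, star_mul])

theorem bidual_star_star (F : Bidual B) : star (star F) = F := by
  obtain ⟨D, _, Φ, hΦ⟩ := exists_injective_bidual_hom B
  exact hΦ (by simp only [map_star, star_star])

theorem eq_zero_of_mul_star_self {F : Bidual B} (h : F * star F = 0) : F = 0 := by
  obtain ⟨D, _, Φ, hΦ⟩ := exists_injective_bidual_hom B
  apply hΦ
  rw [map_zero, ← CStarRing.mul_star_self_eq_zero_iff, ← map_star, ← map_mul, h, map_zero]

end BidualAlgebra

section Preadjoint

variable {A : Type u} {B : Type v} [NonUnitalCStarAlgebra A] [NonUnitalCStarAlgebra B]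

/-- The map `T` between biduals is induced by a map in the opposite direction between the duals;
for linear `T` this is weak⋆ continuity. -/
def HasPreadjoint (T : Bidual A → Bidual B) : Prop :=
  ∀ f : StrongDual ℂ B, ∃ g : StrongDual ℂ A, ∀ F, T F f = F g

theorem HasPreadjoint.ext {S T : Bidual A → Bidual B} (hS : HasPreadjoint S) (hT : HasPreadjoint T)
    (h : ∀ a : A, S (κ a) = T (κ a)) (F : Bidual A) : S F = T F := by
  ext f
  obtain ⟨g, hg⟩ := hS f
  obtain ⟨g', hg'⟩ := hT f
  have hgg' : g = g' := by
    ext a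
    rw [← dual_def ℂ A a g, ← dual_def ℂ A a g', ← hg, ← hg', h]
  rw [hg, hg', hgg']

theorem HasPreadjoint.comp {C : Type w} [NonUnitalCStarAlgebra C] {S : Bidual B → Bidual C}
    {T : Bidual A → Bidual B} (hS : HasPreadjoint S) (hT : HasPreadjoint T) :
    HasPreadjoint (fun F => S (T F)) := by
  intro f
  obtain ⟨g, hg⟩ := hS f
  obtain ⟨k, hk⟩ := hT g
  exact ⟨k, fun F => by rw [hg, hk]⟩

theorem hasPreadjoint_mul_const (G : Bidual B) : HasPreadjoint (fun F : Bidual B => F * G) :=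
  fun f => ⟨bidualAct G f, fun _ => rfl⟩

theorem hasPreadjoint_const_mul (G : Bidual B) : HasPreadjoint (fun F : Bidual B => G * F) := by
  refine fun f => ⟨dualStar (bidualAct (star G) (dualStar f)), fun F => ?_⟩
  change (G * F) f = _
  rw [← bidual_star_star (G * F), bidual_star_mul, bidual_star_apply, bidual_mul_apply,
    bidual_star_apply, star_star]

theorem hasPreadjoint_bitranspose (φ : A →L[ℂ] B) : HasPreadjoint (bitranspose φ) :=
  fun f => ⟨f ∘L φ, fun _ => rfl⟩

theorem bitranspose_inclusion (φ : A →L[ℂ] B) (a : A) : bitranspose φ (κ a) = κ (φ a) := rfl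

/-- The adjoint map `a ↦ (φ a*)*`. -/
def adjointMap (φ : A →L[ℂ] B) : A →L[ℂ] B :=
  LinearMap.mkContinuous
    { toFun := fun a => star (φ (star a))
      map_add' := fun x y => by simp
      map_smul' := fun c x => by simp } ‖φ‖
    (fun x => by simpa using φ.le_opNorm (star x))

theorem adjointMap_apply (φ : A →L[ℂ] B) (a : A) : adjointMap φ a = star (φ (star a)) := rfl

theorem adjointMap_adjointMap (φ : A →L[ℂ] B) : adjointMap (adjointMap φ) = φ := by
  ext a
  rw [adjointMap_apply, adjointMap_apply, star_star, star_star]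

theorem star_bitranspose (φ : A →L[ℂ] B) (F : Bidual A) :
    star (bitranspose φ F) = bitranspose (adjointMap φ) (star F) := by
  ext f
  have h : dualStar (f ∘L adjointMap φ) = dualStar f ∘L φ := by
    ext a
    simp [dualStar_apply, adjointMap_apply]
  rw [bidual_star_apply, bitranspose_apply, bitranspose_apply, bidual_star_apply, h]

end Preadjoint

section WeakLimits

variable {A : Type u} {B : Type v} [NonUnitalCStarAlgebra A] [NonUnitalCStarAlgebra B]
  {ι : Type*} {l : Filter ι} {F F' : ι → Bidual B} {G G' : Bidual B}

/-- Convergence in the weak⋆ topology of the bidual. -/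
def WeakLim (l : Filter ι) (F : ι → Bidual B) (G : Bidual B) : Prop :=
  ∀ f, Tendsto (fun i => F i f) l (𝓝 (G f))

namespace WeakLim

theorem unique [l.NeBot] (h : WeakLim l F G) (h' : WeakLim l F G') : G = G' := by
  ext f
  exact tendsto_nhds_unique (h f) (h' f)

theorem mono {l' : Filter ι} (h : WeakLim l F G) (hl : l' ≤ l) : WeakLim l' F G :=
  fun f => (h f).mono_left hl

theorem star (h : WeakLim l F G) : WeakLim l (fun i => star (F i)) (star G) :=
  fun f => (h (dualStar f)).star

theorem add (h : WeakLim l F G) (h' : WeakLim l F' G') :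
    WeakLim l (fun i => F i + F' i) (G + G') :=
  fun f => (h f).add (h' f)

theorem const_smul (h : WeakLim l F G) (c : ℂ) : WeakLim l (fun i => c • F i) (c • G) :=
  fun f => (h f).const_smul c

theorem const (G : Bidual B) : WeakLim l (fun _ => G) G := fun _ => tendsto_const_nhds

theorem map {T : Bidual B → Bidual A} (hT : HasPreadjoint T) (h : WeakLim l F G) :
    WeakLim l (fun i => T (F i)) (T G) := by
  intro f
  obtain ⟨g, hg⟩ := hT f
  simpa only [hg] using h g

theorem mul_const (h : WeakLim l F G) (H : Bidual B) : WeakLim l (fun i => F i * H) (G * H) :=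
  h.map (hasPreadjoint_mul_const H)

end WeakLim

theorem exists_weakLim_of_eventually_norm_le (U : Ultrafilter ι) {F : ι → Bidual B} {C : ℝ}
    (hF : ∀ᶠ i in U, ‖F i‖ ≤ C) : ∃ G, WeakLim (U : Filter ι) F G := by
  let F' : ι → WeakDual ℂ (StrongDual ℂ B) := fun i => StrongDual.toWeakDual (F i)
  have hmem : WeakDual.toStrongDual ⁻¹' Metric.closedBall (0 : Bidual B) C ∈ U.map F' :=
    Ultrafilter.mem_map.mpr (hF.mono fun i hi =>
      mem_closedBall_zero_iff (E := Bidual B).mpr hi)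
  obtain ⟨G, -, hG⟩ := (WeakDual.isCompact_closedBall (0 : Bidual B) C).ultrafilter_le_nhds _
    (le_principal_iff.mpr hmem)
  exact ⟨WeakDual.toStrongDual G, fun f => ((WeakDual.eval_continuous f).tendsto G).comp hG⟩

/-- A weak⋆ limit of an approximate unit. -/
theorem exists_isUnitElement (A : Type u) [NonUnitalCStarAlgebra A] :
    ∃ e : Bidual A, IsUnitElement e := by
  let _ : PartialOrder A := CStarAlgebra.spectralOrder A
  have _ : StarOrderedRing A := CStarAlgebra.spectralOrderedRing A
  have hU := CStarAlgebra.increasingApproximateUnit A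
  let U : Ultrafilter A := Ultrafilter.of (CStarAlgebra.approximateUnit A)
  have hle : (U : Filter A) ≤ CStarAlgebra.approximateUnit A := Ultrafilter.of_le _
  obtain ⟨e, he⟩ := exists_weakLim_of_eventually_norm_le U (F := fun a => κ a) (C := 1) (by
    filter_upwards [hle hU.eventually_norm] with u hu
    exact (double_dual_bound ℂ A u).trans hu)
  have hright : ∀ F : Bidual A, F * e = F := by
    refine fun F => (hasPreadjoint_mul_const e).ext (fun f => ⟨f, fun _ => rfl⟩) (fun a => ?_) F
    refine (he.map (hasPreadjoint_const_mul (κ a))).unique fun f => ?_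
    exact (f.continuous.tendsto a).comp ((hU.tendsto_mul_left a).mono_left hle)
  have hleft : ∀ F : Bidual A, star e * F = F := by
    intro F
    rw [← bidual_star_star F, ← bidual_star_mul, hright]
  have hstar : star e = e := by rw [← hright (star e), hleft]
  exact ⟨e, fun F => ⟨by conv_lhs => rw [← hstar, hleft], hright F⟩⟩

theorem IsUnitElement.star_eq {e : Bidual A} (he : IsUnitElement e) : star e = e := by
  refine IsUnitElement.unique (fun F => ⟨?_, ?_⟩) he <;>
    rw [← bidual_star_star F, ← bidual_star_mul]
  · rw [(he _).2]
  · rw [(he _).1]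

end WeakLimits

section UnitalModel

/-- A non-unital C⋆-algebra with a two-sided identity `e`, viewed as a unital C⋆-algebra. -/
@[reducible]
def cstarAlgebraOfUnit {D : Type*} [NonUnitalCStarAlgebra D] (e : D)
    (he : ∀ x, e * x = x ∧ x * e = x) : CStarAlgebra D :=
  let _ : Ring D := { (inferInstance : NonUnitalRing D) with
    one := e
    one_mul := fun x => (he x).1
    mul_one := fun x => (he x).2 }
  { ‹NonUnitalCStarAlgebra D›, (inferInstance : Ring D),
    Algebra.ofModule (R := ℂ) (A := D) smul_mul_assoc mul_smul_comm with }

theorem exists_starAlgEquiv (B : Type v) [NonUnitalCStarAlgebra B] :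
    ∃ (D : Type (max v w)) (_ : CStarAlgebra D) (Ψ : Bidual B ≃⋆ₐ[ℂ] D) (C : ℝ),
      0 ≤ C ∧ ∀ F, ‖Ψ F‖ ≤ ‖F‖ ∧ ‖F‖ ≤ C * ‖Ψ F‖ := by
  obtain ⟨D, _, Φ, C, hC, hΦ⟩ := exists_bidual_embedding.{v, w} B
  have hanti : AntilipschitzWith C.toNNReal Φ :=
    AddMonoidHomClass.antilipschitz_of_bound Φ fun F => by
      simpa only [Real.coe_toNNReal C hC] using (hΦ F).2
  have hcont : UniformContinuous Φ :=
    (LipschitzWith.mk_one (f := Φ) fun F G => by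
      rw [dist_eq_norm, ← map_sub]
      exact (hΦ (F - G)).1.trans_eq (dist_eq_norm F G).symm).uniformContinuous
  have _ : IsClosed (NonUnitalStarAlgHom.range Φ : Set D) := by
    rw [NonUnitalStarAlgHom.coe_range]
    exact hanti.isClosed_range hcont
  let Ψ := StarAlgEquiv.ofInjective' Φ hanti.injective
  obtain ⟨e, he⟩ := exists_isUnitElement B
  let _ : CStarAlgebra (NonUnitalStarAlgHom.range Φ) := cstarAlgebraOfUnit (Ψ e) fun x => by
    obtain ⟨F, hF⟩ : ∃ F, Ψ F = x := Ψ.surjective x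
    rw [← hF, ← map_mul, ← map_mul, (he F).1, (he F).2]
    exact ⟨rfl, rfl⟩
  exact ⟨NonUnitalStarAlgHom.range Φ, _, Ψ, C, hC, hΦ⟩

end UnitalModel

section ZeroProducts

variable {K : Type*} [TopologicalSpace K]

/-- The slice `y ∧ i - y ∧ (i - 1)` of `y` between the heights `i - 1` and `i`. The slice `0` of a
nonnegative function is the constant `1`. -/
def slice (y : C(K, ℝ)) (i : ℕ) : C(K, ℝ) :=
  ⟨fun x => min (y x) i - min (y x) (i - 1), by fun_prop⟩

theorem slice_apply (y : C(K, ℝ)) (i : ℕ) (x : K) :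
    slice y i x = min (y x) i - min (y x) (i - 1) := rfl

theorem slice_nonneg (y : C(K, ℝ)) (i : ℕ) (x : K) : 0 ≤ slice y i x :=
  sub_nonneg.mpr (min_le_min_left _ (sub_le_self _ zero_le_one))

theorem slice_le_one (y : C(K, ℝ)) (i : ℕ) (x : K) : slice y i x ≤ 1 := by
  rw [slice_apply]
  rcases min_cases (y x) (i : ℝ) with h | h <;> rcases min_cases (y x) (i - 1 : ℝ) with h' | h' <;>
    linarith

theorem slice_eq_zero_or_eq_one (y : C(K, ℝ)) {i j : ℕ} (hij : i < j) (x : K) :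
    slice y j x = 0 ∨ slice y i x = 1 := by
  have h : (i : ℝ) + 1 ≤ j := by exact_mod_cast hij
  simp only [slice_apply]
  rcases le_total (y x) (j - 1) with hx | hx
  · left
    rw [min_eq_left hx, min_eq_left (by linarith), sub_self]
  · right
    rw [min_eq_right (by linarith), min_eq_right (by linarith), sub_sub_cancel]

theorem slice_mul_one_sub_slice (y : C(K, ℝ)) {i j : ℕ} (hij : i < j) :
    slice y j * (1 - slice y i) = 0 := by
  ext x
  rcases slice_eq_zero_or_eq_one y hij x with h | h <;> simp [h]

theorem slice_succ_le (y : C(K, ℝ)) (i : ℕ) (x : K) : slice y (i + 1) x ≤ slice y i x := by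
  rcases slice_eq_zero_or_eq_one y i.lt_succ_self x with h | h
  · exact h.trans_le (slice_nonneg y i x)
  · exact (slice_le_one y _ x).trans h.ge

theorem sum_slice {y : C(K, ℝ)} (hy : ∀ x, 0 ≤ y x) {n : ℕ} (hn : ∀ x, y x ≤ n) :
    ∑ i ∈ Finset.range n, slice y (i + 1) = y := by
  ext x
  have h := Finset.sum_range_sub (fun i : ℕ => min (y x) (i : ℝ)) n
  simpa [ContinuousMap.sum_apply, slice_apply, hy x, hn x] using h

/-- The tent functions, a partition of unity subordinate to intervals of length `2` of values
of `y`. -/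
def tent (y : C(K, ℝ)) (i : ℕ) : C(K, ℝ) := slice y i - slice y (i + 1)

theorem tent_nonneg (y : C(K, ℝ)) (i : ℕ) (x : K) : 0 ≤ tent y i x :=
  sub_nonneg.mpr (slice_succ_le y i x)

theorem tent_mul_tent (y : C(K, ℝ)) {i j : ℕ} (hij : i + 2 ≤ j ∨ j + 2 ≤ i) :
    tent y i * tent y j = 0 := by
  wlog h : i + 2 ≤ j generalizing i j
  · rw [mul_comm]
    exact this hij.symm (hij.resolve_left h)
  ext x
  rcases slice_eq_zero_or_eq_one y (show i + 1 < j by lia) x with h | h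
  · have h' : slice y (j + 1) x = 0 :=
      le_antisymm ((slice_succ_le y j x).trans h.le) (slice_nonneg y _ x)
    simp [tent, h, h']
  · have h' : slice y i x = 1 :=
      le_antisymm (slice_le_one y _ x) (h.ge.trans (slice_succ_le y i x))
    simp [tent, h, h']

theorem norm_sum_tent_le [CompactSpace K] (y : C(K, ℝ)) (t : Finset ℕ) :
    ‖∑ i ∈ t, tent y i‖ ≤ 1 := by
  rw [ContinuousMap.norm_le _ zero_le_one]
  intro x
  rw [ContinuousMap.sum_apply, Real.norm_of_nonneg (Finset.sum_nonneg fun i _ => tent_nonneg y i x)]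
  obtain ⟨N, hN⟩ := t.exists_nat_subset_range
  calc ∑ i ∈ t, tent y i x
      ≤ ∑ i ∈ Finset.range N, tent y i x :=
        Finset.sum_le_sum_of_subset_of_nonneg hN fun i _ _ => tent_nonneg y i x
    _ = slice y 0 x - slice y N x := Finset.sum_range_sub' (fun i => slice y i x) N
    _ ≤ 1 := by linarith [slice_le_one y 0 x, slice_nonneg y N x]

section Bilinear

variable {R X : Type*} [CommRing R] [Module ℝ R] [AddCommGroup X] [Module ℝ X]
  (W : R →ₗ[ℝ] R →ₗ[ℝ] X) (h0 : ∀ f g, f * g = 0 → W f g = 0)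

include h0

theorem map_sum_map_sum_of_map_zero_product {ι : Type*} (t : Finset ι) (f g : ι → R)
    (hfg : ∀ i ∈ t, ∀ j ∈ t, i ≠ j → f i * g j = 0) :
    W (∑ i ∈ t, f i) (∑ j ∈ t, g j) = ∑ i ∈ t, W (f i) (g i) := by
  rw [map_sum W, LinearMap.sum_apply]
  refine Finset.sum_congr rfl fun i hi => ?_
  rw [map_sum]
  exact Finset.sum_eq_single_of_mem i hi fun j hj hji => h0 _ _ (hfg i hi j hj hji.symm)

theorem map_one_sub_map_one_of_map_zero_product {r₀ r₁ r₂ : R} (h₁₀ : r₁ * (1 - r₀) = 0)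
    (h₂₁ : r₂ * (1 - r₁) = 0) (h₂₀ : r₂ * (1 - r₀) = 0) :
    W r₁ 1 - W 1 r₁ = W (r₁ - r₂) (r₀ - r₁) - W (r₀ - r₁) (r₁ - r₂) := by
  have a₁₀ := h0 _ _ h₁₀
  have a₂₁ := h0 _ _ h₂₁
  have a₂₀ := h0 _ _ h₂₀
  have b₁₀ := h0 _ _ ((mul_comm _ _).trans h₁₀)
  have b₂₁ := h0 _ _ ((mul_comm _ _).trans h₂₁)
  have b₂₀ := h0 _ _ ((mul_comm _ _).trans h₂₀)
  simp only [map_sub, LinearMap.sub_apply] at a₁₀ a₂₁ a₂₀ b₁₀ b₂₁ b₂₀ ⊢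
  linear_combination (norm := module) a₁₀ - b₁₀ + a₂₁ - a₂₀ + b₂₀ - b₂₁

end Bilinear

section Commutator

variable [CompactSpace K] {X : Type*} [NormedAddCommGroup X] [NormedSpace ℝ X]
  (W : C(K, ℝ) →ₗ[ℝ] C(K, ℝ) →ₗ[ℝ] X) (h0 : ∀ f g, f * g = 0 → W f g = 0) {L : ℝ} (hL : 0 ≤ L)
  (hW : ∀ f g, ‖W f g‖ ≤ L * ‖f‖ * ‖g‖)

include h0 hL hW

theorem norm_sum_map_tent_le (y : C(K, ℝ)) (t : Finset ℕ)
    (ht : ∀ i ∈ t, ∀ j ∈ t, i ≠ j → i + 3 ≤ j ∨ j + 3 ≤ i) :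
    ‖∑ i ∈ t, W (tent y (i + 1)) (tent y i)‖ ≤ L ∧
      ‖∑ i ∈ t, W (tent y i) (tent y (i + 1))‖ ≤ L := by
  have h₀ : ‖∑ i ∈ t, tent y i‖ ≤ 1 := norm_sum_tent_le y t
  have h₁ : ‖∑ i ∈ t, tent y (i + 1)‖ ≤ 1 := by
    simpa using norm_sum_tent_le y (t.map (addRightEmbedding 1))
  have h₁₀ := map_sum_map_sum_of_map_zero_product W h0 t
    (fun i => tent y (i + 1)) (tent y) fun i hi j hj hij =>
      tent_mul_tent y (by have := ht i hi j hj hij; lia)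
  have h₀₁ := map_sum_map_sum_of_map_zero_product W h0 t
    (tent y) (fun i => tent y (i + 1)) fun i hi j hj hij =>
      tent_mul_tent y (by have := ht i hi j hj hij; lia)
  rw [← h₁₀, ← h₀₁]
  have hle {f g : C(K, ℝ)} (hf : ‖f‖ ≤ 1) (hg : ‖g‖ ≤ 1) : ‖W f g‖ ≤ L :=
    calc ‖W f g‖ ≤ L * ‖f‖ * ‖g‖ := hW f g
      _ ≤ L * 1 * 1 := by gcongr
      _ = L := by rw [mul_one, mul_one]
  exact ⟨hle h₁ h₀, hle h₀ h₁⟩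

/-- Each of the three residue classes modulo `3` contributes at most `2 L`, as tents whose indices
differ by at least `2` are disjoint. -/
theorem norm_map_one_sub_map_one_le {y : C(K, ℝ)} (hy : ∀ x, 0 ≤ y x) :
    ‖W y 1 - W 1 y‖ ≤ 6 * L := by
  obtain ⟨n, hn⟩ := exists_nat_ge ‖y‖
  have hsum := sum_slice hy fun x => (le_abs_self _).trans ((y.norm_coe_le_norm x).trans hn)
  have hcell (i : ℕ) : W (slice y (i + 1)) 1 - W 1 (slice y (i + 1)) =
      W (tent y (i + 1)) (tent y i) - W (tent y i) (tent y (i + 1)) :=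
    map_one_sub_map_one_of_map_zero_product W h0
      (slice_mul_one_sub_slice y (by lia)) (slice_mul_one_sub_slice y (by lia))
      (slice_mul_one_sub_slice y (by lia))
  have hclass (r : ℕ) : ‖∑ i ∈ Finset.range n with i % 3 = r,
      (W (tent y (i + 1)) (tent y i) - W (tent y i) (tent y (i + 1)))‖ ≤ L + L := by
    have h := norm_sum_map_tent_le W h0 hL hW y {i ∈ Finset.range n | i % 3 = r}
      fun i hi j hj hij => by
        simp only [Finset.mem_filter] at hi hj
        lia
    rw [Finset.sum_sub_distrib]
    exact (norm_sub_le _ _).trans (add_le_add h.1 h.2)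
  calc ‖W y 1 - W 1 y‖
      = ‖∑ i ∈ Finset.range n, (W (slice y (i + 1)) 1 - W 1 (slice y (i + 1)))‖ := by
        rw [Finset.sum_sub_distrib, ← LinearMap.sum_apply, ← map_sum W, ← map_sum, hsum]
    _ = ‖∑ r ∈ Finset.range 3, ∑ i ∈ Finset.range n with i % 3 = r,
          (W (tent y (i + 1)) (tent y i) - W (tent y i) (tent y (i + 1)))‖ := by
        rw [Finset.sum_fiberwise_of_maps_to fun i _ =>
          Finset.mem_range.mpr (Nat.mod_lt i three_pos)]
        simp only [hcell]
    _ ≤ ∑ _r ∈ Finset.range 3, (L + L) := norm_sum_le_of_le _ fun _ _ => hclass _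
    _ = 6 * L := by
        rw [Finset.sum_const, Finset.card_range, nsmul_eq_mul]
        ring

theorem map_one_comm_of_nonneg {y : C(K, ℝ)} (hy : ∀ x, 0 ≤ y x) : W y 1 = W 1 y := by
  by_contra hne
  have hpos : 0 < ‖W y 1 - W 1 y‖ := norm_pos_iff.mpr (sub_ne_zero.mpr hne)
  obtain ⟨n, hn⟩ := Archimedean.arch (6 * L + 1) hpos
  have h := norm_map_one_sub_map_one_le W h0 hL hW (y := n • y) fun x => by
    simpa using nsmul_nonneg (hy x) n
  rw [map_nsmul, map_nsmul, LinearMap.smul_apply, ← nsmul_sub, ← Nat.cast_smul_eq_nsmul ℝ,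
    norm_smul, RCLike.norm_natCast] at h
  rw [nsmul_eq_mul] at hn
  linarith

theorem map_one_comm_of_map_zero_product (y : C(K, ℝ)) : W y 1 = W 1 y := by
  have h := map_one_comm_of_nonneg W h0 hL hW (y := y + ‖y‖ • 1) fun x => by
    simpa using neg_le_iff_add_nonneg.mp (neg_le_of_abs_le (y.norm_coe_le_norm x))
  simpa only [map_add, LinearMap.add_apply, map_smul, LinearMap.smul_apply,
    add_left_inj] using h

end Commutator

theorem map_one_comm_of_isSelfAdjoint {M : Type*} [CStarAlgebra M] {X : Type*}
    [NormedAddCommGroup X] [NormedSpace ℂ X] (W : M →L[ℂ] M →L[ℂ] X)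
    (h0 : ∀ x y, x * y = 0 → W x y = 0) {c : M} (hc : IsSelfAdjoint c) : W c 1 = W 1 c := by
  let Θ : C(spectrum ℝ c, ℝ) →⋆ₐ[ℝ] M := cfcHom hc
  let W' : C(spectrum ℝ c, ℝ) →ₗ[ℝ] C(spectrum ℝ c, ℝ) →ₗ[ℝ] X :=
    LinearMap.mk₂ ℝ (fun f g => W (Θ f) (Θ g)) (by simp) (by simp) (by simp) (by simp)
  have h := map_one_comm_of_map_zero_product W'
    (fun f g hfg => h0 _ _ (by rw [← map_mul, hfg, map_zero])) (norm_nonneg W)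
    (fun f g => by
      rw [← norm_cfcHom c f hc, ← norm_cfcHom c g hc]
      exact W.le_opNorm₂ (Θ f) (Θ g))
    (.restrict (spectrum ℝ c) (.id ℝ))
  change W (Θ _) (Θ 1) = W (Θ 1) (Θ _) at h
  rwa [map_one, show Θ _ = c from cfcHom_id hc] at h

theorem map_one_comm {M : Type*} [CStarAlgebra M] {X : Type*} [NormedAddCommGroup X]
    [NormedSpace ℂ X] (W : M →L[ℂ] M →L[ℂ] X) (h0 : ∀ x y, x * y = 0 → W x y = 0) (c : M) :
    W c 1 = W 1 c := by
  rw [← realPart_add_I_smul_imaginaryPart c]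
  simp only [map_add, map_smul, add_apply, smul_apply,
    map_one_comm_of_isSelfAdjoint W h0 (selfAdjoint.mem_iff.mp (Subtype.property _))]

/-- Apply the unital case to `(x, y) ↦ V (a x) (y b)` on the unitization, of which `A` is an
ideal. -/
theorem balanced_of_map_zero_product {A : Type*} [NonUnitalCStarAlgebra A] {X : Type*}
    [NormedAddCommGroup X] [NormedSpace ℂ X] (V : A →L[ℂ] A →L[ℂ] X)
    (h0 : ∀ x y, x * y = 0 → V x y = 0) (a b c : A) : V (a * c) b = V a (c * b) := by
  let snd : Unitization ℂ A →L[ℂ] A := ⟨Unitization.sndHom ℂ ℂ A, Unitization.continuous_snd⟩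
  have hsnd (x : Unitization ℂ A) (hx : x.fst = 0) : ((snd x : A) : Unitization ℂ A) = x := by
    ext
    · simp [hx]
    · rfl
  have hinr (x : A) : snd (x : Unitization ℂ A) = x := rfl
  let l := snd ∘L ContinuousLinearMap.mul ℂ (Unitization ℂ A) a
  let r := snd ∘L (ContinuousLinearMap.mul ℂ (Unitization ℂ A)).flip b
  have h := map_one_comm (V.bilinearComp l r) (fun x y hxy => h0 _ _ ?_) c
  · change V (snd ((a : Unitization ℂ A) * c)) (snd (1 * (b : Unitization ℂ A))) =
      V (snd ((a : Unitization ℂ A) * 1)) (snd ((c : Unitization ℂ A) * b)) at h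
    rwa [one_mul, mul_one, ← Unitization.inr_mul, ← Unitization.inr_mul, hinr, hinr, hinr,
      hinr] at h
  · apply Unitization.inr_injective (R := ℂ)
    change ((snd ((a : Unitization ℂ A) * x) * snd (y * (b : Unitization ℂ A)) : A) :
      Unitization ℂ A) = _
    rw [Unitization.inr_mul, hsnd _ (by simp), hsnd _ (by simp), mul_assoc, ← mul_assoc x, hxy,
      zero_mul, mul_zero, Unitization.inr_zero]

end ZeroProducts

section RegularizedInverse

variable {D : Type*} [CStarAlgebra D] {k x m : D} {ε : ℝ}

/-- The regularized inverse `(k + ε)⁻¹` of a positive element `k`. -/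
def regInv (k : D) (ε : ℝ) : D := cfc (fun s : ℝ => (s + ε)⁻¹) k

theorem isSelfAdjoint_regInv (k : D) (ε : ℝ) : IsSelfAdjoint (regInv k ε) :=
  cfc_predicate _ k

theorem commute_regInv_left (h : Commute k x) (ε : ℝ) : Commute (regInv k ε) x :=
  h.cfc_real _

variable [PartialOrder D] [StarOrderedRing D]

theorem continuousOn_regInv (hk : 0 ≤ k) (hε : 0 < ε) :
    ContinuousOn (fun s : ℝ => (s + ε)⁻¹) (spectrum ℝ k) :=
  ContinuousOn.inv₀ (by fun_prop) fun _ hs => (add_pos_of_nonneg_of_pos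
    (spectrum_nonneg_of_nonneg hk hs) hε).ne'

theorem regInv_mul_self (hk : 0 ≤ k) (hε : 0 < ε) :
    regInv k ε * k = cfc (fun s : ℝ => (s + ε)⁻¹ * s) k := by
  rw [cfc_mul _ _ k (continuousOn_regInv hk hε), cfc_id' ℝ k, regInv]

theorem one_sub_regInv_mul_self (hk : 0 ≤ k) (hε : 0 < ε) :
    1 - regInv k ε * k = ε • regInv k ε := by
  have hcont := continuousOn_regInv hk hε
  rw [regInv_mul_self hk hε, regInv, ← cfc_const_mul ε _ k hcont, ← cfc_const_one ℝ k,
    ← cfc_sub _ _ k (by fun_prop) (by fun_prop)]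
  refine cfc_congr fun s hs => ?_
  have hs0 : s + ε ≠ 0 := (add_pos_of_nonneg_of_pos (spectrum_nonneg_of_nonneg hk hs) hε).ne'
  change 1 - (s + ε)⁻¹ * s = ε * (s + ε)⁻¹
  field_simp
  ring

theorem norm_regInv_mul_self_le (hk : 0 ≤ k) (hε : 0 < ε) : ‖regInv k ε * k‖ ≤ 1 := by
  rw [regInv_mul_self hk hε]
  refine norm_cfc_le zero_le_one fun s hs => ?_
  have hs0 : 0 ≤ s := spectrum_nonneg_of_nonneg hk hs
  rw [Real.norm_of_nonneg (by positivity), inv_mul_le_one₀ (by positivity)]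
  linarith

theorem norm_regInv_le (hk : 0 ≤ k) (hε : 0 < ε) : ‖regInv k ε‖ ≤ ε⁻¹ := by
  refine norm_cfc_le (by positivity) fun s hs => ?_
  have hs0 : 0 ≤ s := spectrum_nonneg_of_nonneg hk hs
  rw [Real.norm_of_nonneg (by positivity)]
  gcongr
  linarith

theorem norm_mul_sq_le {g : D} (hg : IsSelfAdjoint g) {c : ℝ} (hc : 0 ≤ c)
    (h : x * star x ≤ c • m) : ‖g * x‖ ^ 2 ≤ c * ‖g * m * g‖ := by
  have hconj : g * x * star (g * x) ≤ c • (g * m * g) := by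
    calc g * x * star (g * x) = g * (x * star x) * g := by
          simp only [star_mul, hg.star_eq, mul_assoc]
      _ ≤ g * (c • m) * g := hg.conjugate_le_conjugate h
      _ = c • (g * m * g) := by rw [mul_smul_comm, smul_mul_assoc]
  calc ‖g * x‖ ^ 2 = ‖g * x * star (g * x)‖ := by rw [CStarRing.norm_self_mul_star, sq]
    _ ≤ ‖c • (g * m * g)‖ :=
      CStarAlgebra.norm_le_norm_of_nonneg_of_le (mul_star_self_nonneg _) hconj
    _ = c * ‖g * m * g‖ := by rw [norm_smul, Real.norm_of_nonneg hc]

end RegularizedInverse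

section BalancedFamily

variable {M D ι : Type*} [CStarAlgebra M] [CStarAlgebra D]

theorem mul_star_apply_le [PartialOrder D] [StarOrderedRing D] {X Y : M →ₗ[ℂ] D}
    (hstar : ∀ a, star (X a) = Y (star a)) (hmul : ∀ a b, X a * Y b = X 1 * Y (a * b)) (a : M) :
    X a * star (X a) ≤ (‖a‖ ^ 2) • (X 1 * star (X 1)) := by
  let _ : PartialOrder M := CStarAlgebra.spectralOrder M
  have _ : StarOrderedRing M := CStarAlgebra.spectralOrderedRing M
  have hmul_star (b : M) : X b * star (X b) = X 1 * Y (b * star b) := by rw [hstar, hmul]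
  obtain ⟨d, hd⟩ := CStarAlgebra.nonneg_iff_eq_mul_star_self.mp
    (sub_nonneg.mpr (CStarAlgebra.mul_star_le_algebraMap_norm_sq (a := a)))
  have hd' : d * star d = ((‖a‖ ^ 2 : ℝ) : ℂ) • (1 : M) - a * star a := by
    rw [← hd, Algebra.algebraMap_eq_smul_one, Complex.coe_smul]
  have h := mul_star_self_nonneg (X d)
  rw [hmul_star, hd', map_sub, map_smul, mul_sub, mul_smul_comm, ← hmul_star, Complex.coe_smul,
    sub_nonneg] at h
  rwa [hstar 1, star_one]

/-- A family of linear maps closed under adjoints such that each product `P i a * P j b` depends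
only on `a * b`. -/
structure IsBalancedFamily (P : ι → M →ₗ[ℂ] D) : Prop where
  exists_star_apply : ∀ i, ∃ j, ∀ a, star (P i a) = P j (star a)
  apply_mul_apply : ∀ i j a b, P i a * P j b = P i 1 * P j (a * b)

theorem IsBalancedFamily.apply_mul_star_one {P : ι → M →ₗ[ℂ] D}
    (hP : IsBalancedFamily P) (i : ι) (a : M) :
    P i a * star (P i 1) = P i 1 * star (P i (star a)) := by
  obtain ⟨j, hj⟩ := hP.exists_star_apply i
  rw [hj, hj, star_star, star_one, hP.apply_mul_apply, mul_one]

variable [Fintype ι]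

/-- The map `a ↦ ∑ i, P i a * (P i 1)*`. For the family consisting of `π a * h` and `π a * h*`,
with `π` a ⋆-homomorphism, it is `π a` multiplied by the positive weight `h * h* + h* * h`. -/
def weightedMap (P : ι → M →ₗ[ℂ] D) : M →ₗ[ℂ] D :=
  ∑ i, (LinearMap.mulRight ℂ (star (P i 1))) ∘ₗ P i

theorem weightedMap_apply (P : ι → M →ₗ[ℂ] D) (a : M) :
    weightedMap P a = ∑ i, P i a * star (P i 1) := by
  simp [weightedMap]

theorem weightedMap_one_nonneg [PartialOrder D] [StarOrderedRing D] (P : ι → M →ₗ[ℂ] D) :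
    0 ≤ weightedMap P 1 := by
  rw [weightedMap_apply]
  exact Finset.sum_nonneg fun i _ => mul_star_self_nonneg _

/-- The approximants `(k + ε)⁻¹ * weightedMap P a` of the support homomorphism, where `k` is the
weight `weightedMap P 1`. -/
def supportApprox (P : ι → M →ₗ[ℂ] D) (ε : ℝ) : M →ₗ[ℂ] D :=
  LinearMap.mulLeft ℂ (regInv (weightedMap P 1) ε) ∘ₗ weightedMap P

theorem supportApprox_apply (P : ι → M →ₗ[ℂ] D) (ε : ℝ) (a : M) :
    supportApprox P ε a = regInv (weightedMap P 1) ε * weightedMap P a := rfl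

namespace IsBalancedFamily

variable {P : ι → M →ₗ[ℂ] D}

theorem weightedMap_mul_apply (hP : IsBalancedFamily P) (a : M) (j : ι) (b : M) :
    weightedMap P a * P j b = weightedMap P 1 * P j (a * b) := by
  rw [weightedMap_apply, weightedMap_apply, Finset.sum_mul, Finset.sum_mul]
  refine Finset.sum_congr rfl fun i _ => ?_
  obtain ⟨l, hl⟩ := hP.exists_star_apply i
  rw [hP.apply_mul_star_one, hl, hl, star_star, star_one, mul_assoc, mul_assoc,
    hP.apply_mul_apply l j]

theorem weightedMap_mul_weightedMap (hP : IsBalancedFamily P) (a b : M) :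
    weightedMap P a * weightedMap P b = weightedMap P 1 * weightedMap P (a * b) := by
  rw [weightedMap_apply P b, weightedMap_apply P (a * b), Finset.mul_sum, Finset.mul_sum]
  refine Finset.sum_congr rfl fun i _ => ?_
  rw [← mul_assoc, ← mul_assoc, hP.weightedMap_mul_apply]

theorem commute_weightedMap (hP : IsBalancedFamily P) (a : M) :
    Commute (weightedMap P 1) (weightedMap P a) := by
  rw [commute_iff_eq, hP.weightedMap_mul_weightedMap a, mul_one]

theorem star_weightedMap (hP : IsBalancedFamily P) (a : M) :
    star (weightedMap P a) = weightedMap P (star a) := by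
  simp only [weightedMap_apply, star_sum, star_mul, star_star, hP.apply_mul_star_one]

theorem star_supportApprox (hP : IsBalancedFamily P) (ε : ℝ) (a : M) :
    star (supportApprox P ε a) = supportApprox P ε (star a) := by
  rw [supportApprox_apply, star_mul, hP.star_weightedMap, (isSelfAdjoint_regInv _ _).star_eq,
    ← (commute_regInv_left (hP.commute_weightedMap _) ε).eq, supportApprox_apply]

theorem norm_supportApprox_le (hP : IsBalancedFamily P) {ε : ℝ} (hε : 0 < ε) (a : M) :
    ‖supportApprox P ε a‖ ≤ ‖a‖ := by
  let _ : PartialOrder D := CStarAlgebra.spectralOrder D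
  have _ : StarOrderedRing D := CStarAlgebra.spectralOrderedRing D
  set k := weightedMap P 1
  set g := regInv k ε
  have hk : 0 ≤ k := weightedMap_one_nonneg P
  have hgk : g * k = k * g := (commute_regInv_left (Commute.refl k) ε).eq
  have hle : weightedMap P a * star (weightedMap P a) ≤ (‖a‖ ^ 2) • (k * k) := by
    have h := mul_star_apply_le hP.star_weightedMap hP.weightedMap_mul_weightedMap a
    rwa [hP.star_weightedMap 1, star_one] at h
  have hnorm : ‖g * (k * k) * g‖ ≤ 1 := by
    have h := norm_regInv_mul_self_le hk hε
    calc ‖g * (k * k) * g‖ = ‖(g * k) * (g * k)‖ := by rw [← mul_assoc, mul_assoc, ← hgk]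
      _ ≤ 1 := (norm_mul_le _ _).trans (mul_le_one₀ h (norm_nonneg _) h)
  refine (sq_le_sq₀ (norm_nonneg _) (norm_nonneg a)).mp ?_
  calc ‖g * weightedMap P a‖ ^ 2 ≤ ‖a‖ ^ 2 * ‖g * (k * k) * g‖ :=
        norm_mul_sq_le (isSelfAdjoint_regInv k ε) (sq_nonneg _) hle
    _ ≤ ‖a‖ ^ 2 := mul_le_of_le_one_right (sq_nonneg _) hnorm

theorem norm_sub_supportApprox_mul_sq_le (hP : IsBalancedFamily P) {ε : ℝ} (hε : 0 < ε)
    (a b : M) (j : ι) :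
    ‖P j (a * b) - supportApprox P ε a * P j b‖ ^ 2 ≤ ‖a * b‖ ^ 2 * ε := by
  let _ : PartialOrder D := CStarAlgebra.spectralOrder D
  have _ : StarOrderedRing D := CStarAlgebra.spectralOrderedRing D
  set k := weightedMap P 1
  set g := regInv k ε
  have hk : 0 ≤ k := weightedMap_one_nonneg P
  have hsub : P j (a * b) - supportApprox P ε a * P j b = ε • (g * P j (a * b)) := by
    rw [supportApprox_apply, mul_assoc, hP.weightedMap_mul_apply, ← mul_assoc, ← smul_mul_assoc,
      ← one_sub_regInv_mul_self hk hε, sub_mul, one_mul]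
  have hle : P j (a * b) * star (P j (a * b)) ≤ (‖a * b‖ ^ 2) • k := by
    obtain ⟨i, hi⟩ := hP.exists_star_apply j
    refine (mul_star_apply_le hi (hP.apply_mul_apply j i) _).trans
      (smul_le_smul_of_nonneg_left ?_ (sq_nonneg _))
    exact (Finset.single_le_sum (fun l _ => mul_star_self_nonneg (P l 1))
      (Finset.mem_univ j)).trans_eq (weightedMap_apply P 1).symm
  have hnorm : ‖g * k * g‖ ≤ ε⁻¹ := (norm_mul_le _ _).trans
    ((mul_le_of_le_one_left (norm_nonneg _) (norm_regInv_mul_self_le hk hε)).trans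
      (norm_regInv_le hk hε))
  calc ‖P j (a * b) - supportApprox P ε a * P j b‖ ^ 2
      = ε ^ 2 * ‖g * P j (a * b)‖ ^ 2 := by
        rw [hsub, norm_smul, Real.norm_of_nonneg hε.le, mul_pow]
    _ ≤ ε ^ 2 * (‖a * b‖ ^ 2 * ‖g * k * g‖) := by
        gcongr
        exact norm_mul_sq_le (isSelfAdjoint_regInv k ε) (sq_nonneg _) hle
    _ ≤ ε ^ 2 * (‖a * b‖ ^ 2 * ε⁻¹) := by gcongr
    _ = ‖a * b‖ ^ 2 * ε := by field_simp

theorem tendsto_supportApprox_mul (hP : IsBalancedFamily P) (a b : M) (j : ι) :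
    Tendsto (fun ε => supportApprox P ε a * P j b) (𝓝[>] 0) (𝓝 (P j (a * b))) := by
  have hbound : Tendsto (fun ε : ℝ => ‖a * b‖ ^ 2 * ε) (𝓝[>] 0) (𝓝 0) := by
    have h := (continuous_const_mul (‖a * b‖ ^ 2)).tendsto (0 : ℝ)
    rw [mul_zero] at h
    exact h.mono_left nhdsWithin_le_nhds
  have hsq : Tendsto (fun ε => ‖P j (a * b) - supportApprox P ε a * P j b‖ ^ 2) (𝓝[>] 0) (𝓝 0) :=
    squeeze_zero' (.of_forall fun _ => sq_nonneg _)
      (eventually_mem_nhdsWithin.mono fun _ hε => hP.norm_sub_supportApprox_mul_sq_le hε a b j)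
      hbound
  rw [tendsto_iff_norm_sub_tendsto_zero]
  simpa only [Function.comp_def, norm_sub_rev, Real.sqrt_sq (norm_nonneg _), Real.sqrt_zero] using
    (Real.continuous_sqrt.tendsto 0).comp hsq

theorem supportApprox_mul_eq_zero (hP : IsBalancedFamily P) (ε : ℝ) (a : M) {x : D}
    (hx : ∀ i b, P i b * x = 0) : supportApprox P ε a * x = 0 := by
  have hsum : weightedMap P a * x = 0 := by
    rw [weightedMap_apply, Finset.sum_mul]
    refine Finset.sum_eq_zero fun i _ => ?_
    obtain ⟨j, hj⟩ := hP.exists_star_apply i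
    rw [hj, mul_assoc, hx, mul_zero]
  rw [supportApprox_apply, mul_assoc, hsum, mul_zero]

end IsBalancedFamily

end BalancedFamily

section BalancedBitranspose

variable {A : Type u} {B : Type v} [NonUnitalCStarAlgebra A] [NonUnitalCStarAlgebra B]
  {φ : A →L[ℂ] B}

theorem bitranspose_mul_bitranspose {X Y : A →L[ℂ] B}
    (h : ∀ a b c, X (a * c) * Y b = X a * Y (c * b)) (F G H : Bidual A) :
    bitranspose X (F * G) * bitranspose Y H = bitranspose X F * bitranspose Y (G * H) := by
  have hX := hasPreadjoint_bitranspose X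
  have hY := hasPreadjoint_bitranspose Y
  refine ((hasPreadjoint_const_mul _).comp hY).ext
    ((hasPreadjoint_const_mul _).comp (hY.comp (hasPreadjoint_const_mul G))) (fun b => ?_) H
  refine ((hasPreadjoint_mul_const _).comp (hX.comp (hasPreadjoint_const_mul F))).ext
    ((hasPreadjoint_const_mul _).comp (hY.comp (hasPreadjoint_mul_const _))) (fun c => ?_) G
  refine ((hasPreadjoint_mul_const _).comp (hX.comp (hasPreadjoint_mul_const _))).ext
    ((hasPreadjoint_mul_const _).comp hX) (fun a => ?_) F
  simp only [← inclusion_mul, bitranspose_inclusion, h]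

/-- The pair consisting of `φ` and its adjoint map, indexed by `Bool`. -/
def adjointPair (φ : A →L[ℂ] B) (i : Bool) : A →L[ℂ] B := cond i φ (adjointMap φ)

theorem adjointMap_adjointPair (φ : A →L[ℂ] B) (i : Bool) :
    adjointMap (adjointPair φ i) = adjointPair φ !i := by
  cases i
  · exact adjointMap_adjointMap φ
  · rfl

theorem adjointPair_mul_eq_zero (hrange : PreservesRangeOrthogonality φ)
    (hdomain : PreservesDomainOrthogonality φ) (hzero : PreservesZeroProducts φ) (i j : Bool)
    {a b : A} (hab : a * b = 0) : adjointPair φ i a * adjointPair φ j b = 0 := by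
  cases i <;> cases j
  · change star (φ (star a)) * star (φ (star b)) = 0
    rw [← star_mul, hzero _ _ (by rw [← star_mul, hab, star_zero]), star_zero]
  · exact hrange (star a) b (by rwa [star_star])
  · exact hdomain a (star b) (by rwa [star_star])
  · exact hzero a b hab

theorem bitranspose_adjointPair_mul_eq_zero {x : Bidual B}
    (hx : ∀ b : A, κ (φ b) * x = 0 ∧ κ (star (φ b)) * x = 0) (i : Bool) (F : Bidual A) :
    bitranspose (adjointPair φ i) F * x = 0 := by
  refine ((hasPreadjoint_mul_const x).comp (hasPreadjoint_bitranspose _)).ext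
    (T := fun _ => 0) (fun _ => ⟨0, fun F => (map_zero F).symm⟩) (fun a => ?_) F
  cases i
  · exact (hx (star a)).2
  · exact (hx a).1

variable {M D : Type*} [CStarAlgebra M] [CStarAlgebra D]

/-- The bitransposes of `φ` and its adjoint map, transported to unital C⋆-algebras isomorphic to
the biduals. -/
def bitransposeFamily (ΨA : Bidual A ≃⋆ₐ[ℂ] M) (ΨB : Bidual B ≃⋆ₐ[ℂ] D) (φ : A →L[ℂ] B)
    (i : Bool) : M →ₗ[ℂ] D where
  toFun a := ΨB (bitranspose (adjointPair φ i) (ΨA.symm a))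
  map_add' a b := by simp only [map_add]
  map_smul' c a := by simp only [map_smul, RingHom.id_apply]

variable {ΨA : Bidual A ≃⋆ₐ[ℂ] M} {ΨB : Bidual B ≃⋆ₐ[ℂ] D}

theorem bitransposeFamily_apply (i : Bool) (a : M) :
    bitransposeFamily ΨA ΨB φ i a = ΨB (bitranspose (adjointPair φ i) (ΨA.symm a)) := rfl

theorem bitransposeFamily_inclusion (i : Bool) (a : A) :
    bitransposeFamily ΨA ΨB φ i (ΨA (κ a)) = ΨB (κ (adjointPair φ i a)) := by
  rw [bitransposeFamily_apply, StarAlgEquiv.symm_apply_apply, bitranspose_inclusion]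

theorem bitransposeFamily_mul_eq_zero {x : Bidual B}
    (hx : ∀ b : A, κ (φ b) * x = 0 ∧ κ (star (φ b)) * x = 0) (i : Bool) (m : M) :
    bitransposeFamily ΨA ΨB φ i m * ΨB x = 0 := by
  rw [bitransposeFamily_apply, ← map_mul, bitranspose_adjointPair_mul_eq_zero hx, map_zero]

theorem isBalancedFamily_bitransposeFamily (hrange : PreservesRangeOrthogonality φ)
    (hdomain : PreservesDomainOrthogonality φ) (hzero : PreservesZeroProducts φ) :
    IsBalancedFamily (bitransposeFamily ΨA ΨB φ) where
  exists_star_apply i := ⟨!i, fun a => by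
    rw [bitransposeFamily_apply, bitransposeFamily_apply, ← map_star, star_bitranspose,
      adjointMap_adjointPair, ← map_star ΨA.symm]⟩
  apply_mul_apply i j a b := by
    have hbal := bitranspose_mul_bitranspose (balanced_of_map_zero_product
      ((ContinuousLinearMap.mul ℂ B).bilinearComp (adjointPair φ i) (adjointPair φ j))
      fun _ _ => adjointPair_mul_eq_zero hrange hdomain hzero i j)
    have h := hbal (ΨA.symm 1) (ΨA.symm a) (ΨA.symm b)
    rw [← map_mul, ← map_mul, one_mul] at h
    simp only [bitransposeFamily_apply, ← map_mul, h]

end BalancedBitranspose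

section SupportHom

variable {A : Type u} {B : Type v} [NonUnitalCStarAlgebra A] [NonUnitalCStarAlgebra B]
  {φ : A →L[ℂ] B}

theorem mul_star_eq_zero_of_annihilates {p z : Bidual B}
    (hp : ∀ x : Bidual B, (∀ b : A, κ (φ b) * x = 0 ∧ κ (star (φ b)) * x = 0) → p * x = 0)
    (h : ∀ b, z * κ (φ b) = 0) (h' : ∀ b, z * κ (star (φ b)) = 0) : p * star z = 0 := by
  have h0 : star (0 : Bidual B) = 0 := by
    rw [← map_zero (inclusionInDoubleDual ℂ B), ← inclusion_star, star_zero]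
  refine hp _ fun b => ⟨?_, ?_⟩
  · rw [← bidual_star_star (κ (φ b)), ← bidual_star_mul, ← inclusion_star, h', h0]
  · rw [inclusion_star, ← bidual_star_mul, h, h0]

theorem IsSupportHom.unique {π π' : A →⋆ₙₐ[ℂ] Bidual B} (h : IsSupportHom φ π)
    (h' : IsSupportHom φ π') : π' = π := by
  ext1 a
  rw [← sub_eq_zero]
  have h1 : ∀ b, (π' a - π a) * κ (φ b) = 0 := fun b => by
    rw [sub_mul, h.mul_map, h'.mul_map, sub_self]
  have h2 : ∀ b, (π' a - π a) * κ (star (φ b)) = 0 := fun b => by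
    rw [sub_mul, h.mul_star_map, h'.mul_star_map, sub_self]
  apply eq_zero_of_mul_star_self
  rw [sub_mul, mul_star_eq_zero_of_annihilates (h.mul_eq_zero a) h1 h2,
    mul_star_eq_zero_of_annihilates (h'.mul_eq_zero a) h1 h2, sub_self]

theorem mul_bitranspose {p : Bidual B} {a : A} (h : ∀ b, p * κ (φ b) = κ (φ (a * b)))
    (F : Bidual A) : p * bitranspose φ F = bitranspose φ (κ a * F) :=
  ((hasPreadjoint_const_mul p).comp (hasPreadjoint_bitranspose φ)).ext
    ((hasPreadjoint_bitranspose φ).comp (hasPreadjoint_const_mul (κ a))) h F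

theorem IsSupportHom.isWeightedBy {π : A →⋆ₙₐ[ℂ] Bidual B} (h : IsSupportHom φ π) {e : Bidual A}
    (he : IsUnitElement e) : IsWeightedBy φ (bitranspose φ e) π := by
  refine fun a => ⟨?_, ?_⟩
  · have hstar : π (star a) * bitranspose (adjointMap φ) e = star (κ (φ a)) := by
      rw [mul_bitranspose (a := star a) fun b => ?_, (he _).2, bitranspose_inclusion,
        adjointMap_apply, star_star, inclusion_star]
      rw [adjointMap_apply, h.mul_star_map, adjointMap_apply, star_mul]
    rw [← bidual_star_star (bitranspose φ e * π a), bidual_star_mul, ← map_star, star_bitranspose,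
      he.star_eq, hstar, bidual_star_star]
  · rw [mul_bitranspose (h.mul_map a), (he _).2, bitranspose_inclusion]

/-- Multiplicativity is automatic: `T a * T b - T (a * b)` annihilates the ranges of `φ` and its
adjoint map. -/
theorem exists_isSupportHom_of_linearMap (T : A →ₗ[ℂ] Bidual B)
    (hstar : ∀ a, T (star a) = star (T a))
    (hmap : ∀ a b, T a * κ (φ b) = κ (φ (a * b)))
    (hmap_star : ∀ a b, T a * κ (star (φ b)) = κ (star (φ (b * star a))))
    (hann : ∀ (a : A) (x : Bidual B),
      (∀ b, κ (φ b) * x = 0 ∧ κ (star (φ b)) * x = 0) → T a * x = 0) :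
    ∃ π : A →⋆ₙₐ[ℂ] Bidual B, IsSupportHom φ π := by
  have hmul (a b : A) : T (a * b) = T a * T b := by
    have hz (c : A) : T c * star (T a * T b - T (a * b)) = 0 := by
      refine mul_star_eq_zero_of_annihilates (hann c) (fun d => ?_) fun d => ?_
      · rw [sub_mul, mul_assoc, hmap, hmap, hmap, mul_assoc, sub_self]
      · rw [sub_mul, mul_assoc, hmap_star, hmap_star, hmap_star, star_mul, mul_assoc, sub_self]
    rw [eq_comm, ← sub_eq_zero]
    apply eq_zero_of_mul_star_self
    rw [sub_mul, mul_assoc, hz, hz, mul_zero, sub_zero]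
  let π : A →⋆ₙₐ[ℂ] Bidual B :=
    { toFun := T
      map_smul' := map_smul T
      map_zero' := map_zero T
      map_add' := map_add T
      map_mul' := hmul
      map_star' := hstar }
  exact ⟨π, hmap, hmap_star, hann⟩

theorem exists_linearMap_weakLim {ι : Type*} (U : Ultrafilter ι) {T : ι → A →ₗ[ℂ] Bidual B} {C : ℝ}
    (hT : ∀ᶠ i in U, ∀ a, ‖T i a‖ ≤ C * ‖a‖) :
    ∃ S : A →ₗ[ℂ] Bidual B, ∀ a, WeakLim (U : Filter ι) (fun i => T i a) (S a) := by
  choose S hS using fun a => exists_weakLim_of_eventually_norm_le U (hT.mono fun _ hi => hi a)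
  exact ⟨
    { toFun := S
      map_add' := fun a b => (hS (a + b)).unique (by simpa only [map_add] using (hS a).add (hS b))
      map_smul' := fun c a => (hS (c • a)).unique (by
        simpa only [map_smul, RingHom.id_apply] using (hS a).const_smul c) }, hS⟩

theorem weakLim_of_tendsto {D ι : Type*} [NonUnitalCStarAlgebra D] {l : Filter ι}
    {F : ι → Bidual B} {G : Bidual B} {Ψ : Bidual B ≃⋆ₐ[ℂ] D} {C : ℝ}
    (hΨ : ∀ F, ‖F‖ ≤ C * ‖Ψ F‖) (h : Tendsto (fun i => Ψ (F i)) l (𝓝 (Ψ G))) :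
    WeakLim l F G := by
  intro f
  have hlim := ((tendsto_iff_norm_sub_tendsto_zero.mp h).const_mul C).mul_const ‖f‖
  rw [mul_zero, zero_mul] at hlim
  refine tendsto_iff_norm_sub_tendsto_zero.mpr (squeeze_zero (fun _ => norm_nonneg _)
    (fun i => ?_) hlim)
  rw [← map_sub]
  exact ((F i - G).le_opNorm f).trans (by gcongr; exact hΨ _)

variable {M D : Type*} [CStarAlgebra M] [CStarAlgebra D] {ΨA : Bidual A ≃⋆ₐ[ℂ] M}
  {ΨB : Bidual B ≃⋆ₐ[ℂ] D}

/-- The approximants of the support ⋆-homomorphism of `φ`, as maps into `B**`. -/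
def bidualApprox (ΨA : Bidual A ≃⋆ₐ[ℂ] M) (ΨB : Bidual B ≃⋆ₐ[ℂ] D) (φ : A →L[ℂ] B) (ε : ℝ) :
    A →ₗ[ℂ] Bidual B where
  toFun a := ΨB.symm (supportApprox (bitransposeFamily ΨA ΨB φ) ε (ΨA (κ a)))
  map_add' a b := by simp only [map_add]
  map_smul' c a := by simp only [map_smul, RingHom.id_apply]

theorem map_bidualApprox (ε : ℝ) (a : A) :
    ΨB (bidualApprox ΨA ΨB φ ε a) =
      supportApprox (bitransposeFamily ΨA ΨB φ) ε (ΨA (κ a)) :=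
  ΨB.apply_symm_apply _

theorem star_bidualApprox (hP : IsBalancedFamily (bitransposeFamily ΨA ΨB φ)) (ε : ℝ) (a : A) :
    star (bidualApprox ΨA ΨB φ ε a) = bidualApprox ΨA ΨB φ ε (star a) :=
  EquivLike.injective ΨB (by
    rw [map_star ΨB, map_bidualApprox, map_bidualApprox, hP.star_supportApprox, inclusion_star,
      map_star ΨA])

theorem norm_bidualApprox_le (hP : IsBalancedFamily (bitransposeFamily ΨA ΨB φ))
    (hΨA : ∀ F, ‖ΨA F‖ ≤ ‖F‖) {C : ℝ} (hC : 0 ≤ C) (hΨB : ∀ F, ‖F‖ ≤ C * ‖ΨB F‖) {ε : ℝ}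
    (hε : 0 < ε) (a : A) : ‖bidualApprox ΨA ΨB φ ε a‖ ≤ C * ‖a‖ := by
  calc ‖bidualApprox ΨA ΨB φ ε a‖ ≤ C * ‖ΨB (bidualApprox ΨA ΨB φ ε a)‖ := hΨB _
    _ ≤ C * ‖a‖ := by
      rw [map_bidualApprox]
      gcongr
      exact ((hP.norm_supportApprox_le hε _).trans (hΨA _)).trans (double_dual_bound ℂ A a)

theorem weakLim_bidualApprox_mul (hP : IsBalancedFamily (bitransposeFamily ΨA ΨB φ)) {C : ℝ}
    (hΨB : ∀ F, ‖F‖ ≤ C * ‖ΨB F‖) (i : Bool) (a b : A) :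
    WeakLim (𝓝[>] 0) (fun ε => bidualApprox ΨA ΨB φ ε a * κ (adjointPair φ i b))
      (κ (adjointPair φ i (a * b))) := by
  refine weakLim_of_tendsto hΨB ?_
  have h := hP.tendsto_supportApprox_mul (ΨA (κ a)) (ΨA (κ b)) i
  rw [← map_mul, ← inclusion_mul] at h
  simpa only [map_mul, map_bidualApprox, bitransposeFamily_inclusion] using h

theorem bidualApprox_mul_eq_zero (hP : IsBalancedFamily (bitransposeFamily ΨA ΨB φ))
    {x : Bidual B} (hx : ∀ b : A, κ (φ b) * x = 0 ∧ κ (star (φ b)) * x = 0) (ε : ℝ) (a : A) :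
    bidualApprox ΨA ΨB φ ε a * x = 0 :=
  EquivLike.injective ΨB (by
    rw [map_mul, map_bidualApprox, map_zero]
    exact hP.supportApprox_mul_eq_zero ε _ (bitransposeFamily_mul_eq_zero hx))

theorem exists_isSupportHom (hrange : PreservesRangeOrthogonality φ)
    (hdomain : PreservesDomainOrthogonality φ) (hzero : PreservesZeroProducts φ) :
    ∃ π : A →⋆ₙₐ[ℂ] Bidual B, IsSupportHom φ π := by
  obtain ⟨M, _, ΨA, CA, -, hΨA⟩ := exists_starAlgEquiv.{u, u} A
  obtain ⟨D, _, ΨB, C, hC, hΨB⟩ := exists_starAlgEquiv.{v, v} B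
  have hP : IsBalancedFamily (bitransposeFamily ΨA ΨB φ) :=
    isBalancedFamily_bitransposeFamily hrange hdomain hzero
  let U : Ultrafilter ℝ := Ultrafilter.of (𝓝[>] 0)
  have hU : (U : Filter ℝ) ≤ 𝓝[>] 0 := Ultrafilter.of_le _
  obtain ⟨T, hT⟩ := exists_linearMap_weakLim U (T := bidualApprox ΨA ΨB φ) (C := C)
    (mem_of_superset (hU self_mem_nhdsWithin) fun ε hε =>
      norm_bidualApprox_le hP (fun F => (hΨA F).1) hC (fun F => (hΨB F).2) hε)
  have hmap (i : Bool) (a b : A) : T a * κ (adjointPair φ i b) = κ (adjointPair φ i (a * b)) :=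
    ((hT a).mul_const _).unique
      ((weakLim_bidualApprox_mul hP (fun F => (hΨB F).2) i a b).mono hU)
  refine exists_isSupportHom_of_linearMap T (fun a => (hT (star a)).unique ?_) (hmap true)
    (fun a b => ?_) fun a x hx => ((hT a).mul_const x).unique ?_
  · simpa only [star_bidualApprox hP] using (hT a).star
  · simpa only [adjointPair, cond_false, adjointMap_apply, star_mul, star_star] using
      hmap false a (star b)
  · simpa only [bidualApprox_mul_eq_zero hP hx] using WeakLim.const 0

end SupportHom

section WeightedStarHom

variable {A : Type u} {B : Type v} [NonUnitalCStarAlgebra A] [NonUnitalCStarAlgebra B]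
  {φ : A →L[ℂ] B}

theorem IsWeightedStarHom.preserves (h : IsWeightedStarHom.{u, v, w} φ) :
    PreservesRangeOrthogonality φ ∧ PreservesDomainOrthogonality φ ∧ PreservesZeroProducts φ := by
  obtain ⟨D, _, i, π, d, hi, hφ⟩ := h
  refine ⟨fun a b hab => hi ?_, fun a b hab => hi ?_, fun a b hab => hi ?_⟩
  · rw [map_mul, map_star, (hφ a).2, (hφ b).2, star_mul, ← map_star, mul_assoc,
      ← mul_assoc (π (star a)), ← map_mul, hab, map_zero, zero_mul, mul_zero, map_zero]
  · rw [map_mul, map_star, (hφ a).1, (hφ b).1, star_mul, ← map_star, mul_assoc,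
      ← mul_assoc (π a), ← map_mul, hab, map_zero, zero_mul, mul_zero, map_zero]
  · rw [map_mul, (hφ a).1, (hφ b).2, mul_assoc, ← mul_assoc (π a), ← map_mul, hab, map_zero,
      zero_mul, mul_zero, map_zero]

theorem IsWeightedBy.isWeightedStarHom {H : Bidual B} {π : A →⋆ₙₐ[ℂ] Bidual B}
    (h : IsWeightedBy φ H π) : IsWeightedStarHom.{u, v, w} φ := by
  obtain ⟨D, _, Ψ, -⟩ := exists_starAlgEquiv.{v, w} B
  let κB : B →⋆ₙₐ[ℂ] Bidual B :=
    { toFun := κ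
      map_smul' := map_smul _
      map_zero' := map_zero _
      map_add' := map_add _
      map_mul' := inclusion_mul
      map_star' := inclusion_star }
  refine ⟨D, inferInstance, (Ψ : Bidual B →⋆ₙₐ[ℂ] D).comp κB, (Ψ : Bidual B →⋆ₙₐ[ℂ] D).comp π,
    Ψ H, Ψ.injective.comp inclusion_injective, fun a => ⟨?_, ?_⟩⟩
  · exact (congrArg Ψ (h a).1).trans (map_mul Ψ _ _)
  · exact (congrArg Ψ (h a).2).trans (map_mul Ψ _ _)

end WeightedStarHom

end CStarBidual

end

open CStarBidual in
theorem theorem4p2 {A : Type u} {B : Type v} [NonUnitalCStarAlgebra A] [NonUnitalCStarAlgebra B]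
    (φ : A →L[ℂ] B) :
    ∃ e : Bidual A, IsUnitElement e ∧
      List.TFAE [
        IsWeightedStarHom.{u, v, w} φ,
        ∃ π : A →⋆ₙₐ[ℂ] Bidual B, IsWeightedBy φ (bitranspose φ e) π,
        PreservesRangeOrthogonality φ ∧ PreservesDomainOrthogonality φ ∧
          PreservesZeroProducts φ] ∧
      (PreservesRangeOrthogonality φ ∧ PreservesDomainOrthogonality φ ∧
          PreservesZeroProducts φ →
        ∃ π : A →⋆ₙₐ[ℂ] Bidual B, IsSupportHom φ π ∧ IsWeightedBy φ (bitranspose φ e) π ∧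
          ∀ π' : A →⋆ₙₐ[ℂ] Bidual B, IsSupportHom φ π' → π' = π) := by
  obtain ⟨e, he⟩ := exists_isUnitElement A
  have hsupport : PreservesRangeOrthogonality φ ∧ PreservesDomainOrthogonality φ ∧
      PreservesZeroProducts φ →
        ∃ π : A →⋆ₙₐ[ℂ] Bidual B, IsSupportHom φ π ∧ IsWeightedBy φ (bitranspose φ e) π ∧
          ∀ π' : A →⋆ₙₐ[ℂ] Bidual B, IsSupportHom φ π' → π' = π := by
    rintro ⟨hrange, hdomain, hzero⟩
    obtain ⟨π, hπ⟩ := exists_isSupportHom hrange hdomain hzero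
    exact ⟨π, hπ, hπ.isWeightedBy he, fun _ => hπ.unique⟩
  refine ⟨e, he, ?_, hsupport⟩
  tfae_have 1 → 3 := IsWeightedStarHom.preserves
  tfae_have 2 → 1 := fun ⟨_, hπ⟩ => hπ.isWeightedStarHom
  tfae_have 3 → 2 := fun h => (hsupport h).imp fun _ hπ => hπ.2.1
  tfae_finish
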